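/- **Setting.** Fix a relational schema: relation names $R$ with finite attribute sets $\mathrm{Attr}(R)$, pairwise disjoint infinite sets of tuples of type $R$, and an infinite set of variables, each with a relation name as its type. An operation on a tuple (or variable) of type $R$ is a read $\mathtt R$, a write $\mathtt W$ or an atomic update $\mathtt U$; it has sets $\mathrm{ReadSet},\mathrm{WriteSet}\subseteq \mathrm{Attr}(R)$, with $\mathrm{WriteSet}=\emptyset$ for $\mathtt R$ and $\mathrm{ReadSet}=\emptyset$ for $\mathtt W$. Read operations are $\mathtt R$ and $\mathtt U$, write operations are $\mathtt W$ and $\mathtt U$. A transaction $T$ (a template $\tau$) is a finite sequence of operations on tuples (on variables) followed by a commit; $C_i$ denotes the commit of $T_i$ and $\mathrm{first}(T_i)$ its first operation. *Schedules.* A schedule $s$ over a finite set $\mathcal T$ of transactions (with unique ids) consists of a linear order $<_s$ on all their operations and an initial operation $op_0$, which comes first, extending the order of each transaction; a version order $\ll_s$ that totally orders, for each tuple, the write operations on it, with $op_0$ below all of them; and a version function $v_s$ mapping each read operation $a$ to $op_0$ or to a write operation on the same tuple, with $v_s(a)<_s a$. Operations $b,a$ of different transactions on the same tuple are ww-, wr-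 or rw-conflicting if, respectively, $\mathrm{WriteSet}(b)\cap\mathrm{WriteSet}(a)$, $\mathrm{WriteSet}(b)\cap\mathrm{ReadSet}(a)$, $\mathrm{ReadSet}(b)\cap\mathrm{WriteSet}(a)$ is nonempty. Then $a$ depends on $b$ if they are ww-conflicting and $b\ll_s a$; or wr-conflicting and $b=v_s(a)$ or $b\ll_s v_s(a)$; or rw-conflicting and $v_s(b)\ll_s a$ (an rw-antidependency). The schedule $s$ is conflict-serializable if it has the same dependencies as some schedule over $\mathcal T$ that is serial (transactions are not interleaved) and single version ($\ll_s$ agrees with $<_s$ on the writes on each tuple, and no write on the tuple of a read operation $a$ lies strictly between $v_s(a)$ and $a$). *Isolation levels.* A write operation of $T_j$ respects the commit order if for every write operation of another transaction $T_i$ on the same tuple, the former is $\ll_s$-below the latter iff $C_j<_sC_i$. A read operation $o$ of $T_j$ is read-last-committed relative to $a\in T_j$ if $v_s(o)=op_0$ or $v_s(o)$ belongs to some $T_i$ with $C_i<_s a$, and no write $o_k$ of some $T_k$ on the same tuple has $C_k<_s a$ and $v_s(o)\ll_s o_k$. $T_j$ exhibits a dirty (concurrent) write if there are write operations $b$ of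 some $T_i\ne T_j$ and $a$ of $T_j$ on the same tuple with $b<_sa<_sC_i$ (with $b<_s a$ and $\mathrm{first}(T_j)<_sC_i$). $T_j$ is allowed under RC (under SI) if its writes respect the commit order, each of its reads is read-last-committed relative to itself (relative to $\mathrm{first}(T_j)$), and it exhibits no dirty (no concurrent) write. $T_i,T_j$ are concurrent if $\mathrm{first}(T_i)<_sC_j$ and $\mathrm{first}(T_j)<_sC_i$. A dangerous structure $T_1\to T_2\to T_3$ ($T_1=T_3$ is possible) consists of rw-antidependencies from $T_1$ to $T_2$ and from $T_2$ to $T_3$ such that $T_1,T_2$ and $T_2,T_3$ are concurrent, $C_3\le_sC_1$, $C_3<_sC_2$, and, if $T_1$ has no write operation, $C_3<_s\mathrm{first}(T_1)$. For an allocation $\mathcal A:\mathcal T\to\{\mathrm{RC},\mathrm{SI},\mathrm{SSI}\}$, $s$ is allowed under $\mathcal A$ if every $T$ with $\mathcal A(T)=\mathrm{RC}$ is allowed under RC, every $T$ with $\mathcal A(T)\in\{\mathrm{SI},\mathrm{SSI}\}$ is allowed under SI, and no dangerous structure consists of transactions with level SSI only. *Template robustness.* Let $\mathcal P$ be a set of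 templates and let $A:\mathcal P\to\{\mathrm{RC},\mathrm{SI},\mathrm{SSI}\}$ be a template allocation. A database $\mathbf D$ assigns to every $R$ a finite set of tuples of type $R$; $T$ is instantiated from $\tau$ over $\mathbf D$ if $T=\mu(\tau)$ for a type-preserving map $\mu$ from variables to tuples of $\mathbf D$. $\mathcal P$ is robust against $A$ if for every database $\mathbf D$, every finite set $\mathcal T$ of transactions instantiated from templates of $\mathcal P$ over $\mathbf D$, and every allocation $\mathcal A$ such that each $T\in\mathcal T$ is instantiated over $\mathbf D$ from some $\tau\in\mathcal P$ with $\mathcal A(T)=A(\tau)$, every schedule over $\mathcal T$ allowed under $\mathcal A$ is conflict-serializable. Levels are ordered by $\mathrm{RC}<\mathrm{SI}<\mathrm{SSI}$, template allocations pointwise, and $A[\tau\mapsto I]$ is $A$ with the level of $\tau$ changed to $I$. **Proposition.** Let $\mathcal P$ be a set of templates and let $A_1,A_2$ be two template allocations for $\mathcal P$. 1. If $A_1\le A_2$ and $\mathcal P$ is robust against $A_1$, then $\mathcal P$ is robust against $A_2$. 2. Suppose that every write operation in every template of $\mathcal P$ has a nonempty $\mathrm{WriteSet}$. If $\mathcal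 P$ is robust against both $A_1$ and $A_2$, then $\mathcal P$ is robust against $A_2[\tau\mapsto A_1(\tau)]$ for every $\tau\in\mathcal P$. -/

import Mathlib

namespace TxnRobustness

/-- A relational schema: relation names with their finite sets of attribute names, an infinite set
of abstract tuples for every relation name (each tuple has exactly one type), and an infinite set of
typed variables. -/
structure Schema where
  Rel : Type*
  AttrName : Type*
  Attr : Rel → Finset AttrName
  Obj : Type*
  objType : Obj → Rel
  obj_infinite : ∀ R, {t | objType t = R}.Infinite
  Var : Type*
  varType : Var → Rel
  var_infinite : Infinite Var

/-- A database assigns to every relation name a finite set of tuples of that type. -/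
structure Database (S : Schema) where
  tuples : S.Rel → Finset S.Obj
  type_eq : ∀ R, ∀ t ∈ tuples R, S.objType t = R

inductive OpKind
  | read
  | write
  | update

/-- A (non-commit) operation on an element of a typed carrier `X`: tuples in the case of
transactions, variables in the case of templates. -/
structure Operation (S : Schema) (X : Type*) (type : X → S.Rel) where
  kind : OpKind
  target : X
  readSet : Set S.AttrName
  writeSet : Set S.AttrName
  readSet_subset : readSet ⊆ S.Attr (type target)
  writeSet_subset : writeSet ⊆ S.Attr (type target)
  writeSet_of_read : kind = .read → writeSet = ∅
  readSet_of_write : kind = .write → readSet = ∅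

namespace Operation

variable {S : Schema} {X : Type*} {type : X → S.Rel}

/-- Read operations are the `R`- and the `U`-operations. -/
def IsRead (o : Operation S X type) : Prop := o.kind = .read ∨ o.kind = .update

/-- Write operations are the `W`- and the `U`-operations. -/
def IsWrite (o : Operation S X type) : Prop := o.kind = .write ∨ o.kind = .update

end Operation

/-- A transaction: a finite sequence of operations on tuples. The commit that follows these
operations is not listed; it appears as `Event.commit` in schedules. -/
abbrev Transaction (S : Schema) := List (Operation S S.Obj S.objType)

/-- A transaction template: a transaction over variables. -/
abbrev Template (S : Schema) := List (Operation S S.Var S.varType)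

/-- A variable assignment maps every variable to a tuple of the same type. -/
structure VarAssignment (S : Schema) where
  toFun : S.Var → S.Obj
  type_eq : ∀ x, S.objType (toFun x) = S.varType x

namespace VarAssignment

variable {S : Schema}

/-- The assignment takes its values in the database `D`. -/
def IsFor (μ : VarAssignment S) (D : Database S) : Prop :=
  ∀ x, ∃ R, μ.toFun x ∈ D.tuples R

/-- Replace the variable of an operation by the tuple assigned to it. -/
def applyOp (μ : VarAssignment S) (o : Operation S S.Var S.varType) :
    Operation S S.Obj S.objType where
  kind := o.kind
  target := μ.toFun o.target
  readSet := o.readSet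
  writeSet := o.writeSet
  readSet_subset := by rw [μ.type_eq]; exact o.readSet_subset
  writeSet_subset := by rw [μ.type_eq]; exact o.writeSet_subset
  writeSet_of_read := o.writeSet_of_read
  readSet_of_write := o.readSet_of_write

/-- The transaction `μ(τ)`. -/
def apply (μ : VarAssignment S) (τ : Template S) : Transaction S := τ.map μ.applyOp

end VarAssignment

/-- `T` is instantiated from the template `τ` over the database `D`. -/
def InstantiatedFrom {S : Schema} (T : Transaction S) (τ : Template S) (D : Database S) : Prop :=
  ∃ μ : VarAssignment S, μ.IsFor D ∧ T = μ.apply τ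

/-- A finite set of transactions, with `Fin m` as the set of transaction ids. Different ids may
carry the same sequence of operations. -/
abbrev TransactionSet (S : Schema) (m : ℕ) := Fin m → Transaction S

section Schedules

variable {S : Schema} {m : ℕ} (𝒯 : TransactionSet S m)

/-- Occurrence of a read or write operation in a set of transactions: the transaction id and the
position in that transaction. -/
abbrev Act := Σ i : Fin m, Fin (𝒯 i).length

/-- The operations of a schedule: the initial operation `op₀`, the read and write operations,
and the commits. -/
inductive Event
  | init : Event
  | act : Act 𝒯 → Event
  | commit : Fin m → Event

variable {𝒯}

/-- The operation occurring at `a`. -/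
def Act.op (a : Act 𝒯) : Operation S S.Obj S.objType := (𝒯 a.1).get a.2

/-- `e` is a write operation on the tuple `t`. -/
def Event.IsWriteOn (e : Event 𝒯) (t : S.Obj) : Prop :=
  ∃ a : Act 𝒯, e = .act a ∧ (Act.op a).IsWrite ∧ (Act.op a).target = t

/-- `e` is an operation (possibly the commit) of transaction `i`. -/
def Event.InTxn (e : Event 𝒯) (i : Fin m) : Prop :=
  e = .commit i ∨ ∃ a : Act 𝒯, e = .act a ∧ a.1 = i

/-- The strict order of the operations inside transaction `i`. -/
def TxnLT (i : Fin m) (e f : Event 𝒯) : Prop :=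
  (∃ k l : Fin (𝒯 i).length, k < l ∧ e = .act ⟨i, k⟩ ∧ f = .act ⟨i, l⟩) ∨
    (∃ k : Fin (𝒯 i).length, e = .act ⟨i, k⟩ ∧ f = .commit i)

variable (𝒯) in
/-- The first operation of transaction `i` (its commit if it has no other operation). -/
def first (i : Fin m) : Event 𝒯 :=
  if h : 0 < (𝒯 i).length then .act ⟨i, ⟨0, h⟩⟩ else .commit i

variable (𝒯) in
/-- A multiversion schedule over `𝒯`: `lt` is the strict order of the operations, `vlt` the strict
version order and `vf` the version function (only its values on read operations matter). -/
structure Schedule where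
  lt : Event 𝒯 → Event 𝒯 → Prop
  vlt : Event 𝒯 → Event 𝒯 → Prop
  vf : Act 𝒯 → Event 𝒯
  lt_irrefl : ∀ e, ¬ lt e e
  lt_trans : ∀ e f g, lt e f → lt f g → lt e g
  lt_total : ∀ e f, e ≠ f → lt e f ∨ lt f e
  init_lt : ∀ e, e ≠ .init → lt .init e
  txn_lt : ∀ i e f, TxnLT i e f → lt e f
  -- the version order relates `op₀` to the writes, and the writes on each tuple to each other
  vlt_dom : ∀ e f, vlt e f → ∃ t, (e = .init ∨ e.IsWriteOn t) ∧ f.IsWriteOn t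
  vlt_irrefl : ∀ e, ¬ vlt e e
  vlt_trans : ∀ e f g, vlt e f → vlt f g → vlt e g
  vlt_total : ∀ t e f, e.IsWriteOn t → f.IsWriteOn t → e ≠ f → vlt e f ∨ vlt f e
  init_vlt : ∀ t e, e.IsWriteOn t → vlt .init e
  vf_lt : ∀ a : Act 𝒯, (Act.op a).IsRead → lt (vf a) (.act a)
  vf_write : ∀ a : Act 𝒯, (Act.op a).IsRead →
    vf a = .init ∨ (vf a).IsWriteOn (Act.op a).target

/-- Operations on the same tuple from different transactions. -/
def SameTupleDiffTxn (a b : Act 𝒯) : Prop :=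
  a.1 ≠ b.1 ∧ (Act.op a).target = (Act.op b).target

/-- `a` is ww-conflicting with `b`. -/
def WWConflict (a b : Act 𝒯) : Prop :=
  SameTupleDiffTxn a b ∧ ((Act.op a).writeSet ∩ (Act.op b).writeSet).Nonempty

/-- `a` is wr-conflicting with `b`. -/
def WRConflict (a b : Act 𝒯) : Prop :=
  SameTupleDiffTxn a b ∧ ((Act.op a).writeSet ∩ (Act.op b).readSet).Nonempty

/-- `a` is rw-conflicting with `b`. -/
def RWConflict (a b : Act 𝒯) : Prop :=
  SameTupleDiffTxn a b ∧ ((Act.op a).readSet ∩ (Act.op b).writeSet).Nonempty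

/-- `a` and `b` are conflicting. -/
def Conflict (a b : Act 𝒯) : Prop := WWConflict a b ∨ WRConflict a b ∨ RWConflict a b

variable (𝒯) in
/-- Transaction `i` contains no write operation. -/
def ReadOnly (i : Fin m) : Prop :=
  ∀ a : Act 𝒯, a.1 = i → ¬ (Act.op a).IsWrite

namespace Schedule

variable (s : Schedule 𝒯)

/-- There is a ww-dependency from `b` to `a`. -/
def WWDep (b a : Act 𝒯) : Prop := WWConflict b a ∧ s.vlt (.act b) (.act a)

/-- There is a wr-dependency from `b` to `a`. -/
def WRDep (b a : Act 𝒯) : Prop :=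
  WRConflict b a ∧ (.act b = s.vf a ∨ s.vlt (.act b) (s.vf a))

/-- There is an rw-antidependency from `b` to `a`. -/
def RWDep (b a : Act 𝒯) : Prop := RWConflict b a ∧ s.vlt (s.vf b) (.act a)

/-- `b →ₛ a`: the operation `a` depends on the operation `b`. -/
def Dep (b a : Act 𝒯) : Prop := s.WWDep b a ∨ s.WRDep b a ∨ s.RWDep b a

/-- Single version schedules: the version order is compatible with the order of the operations and
every read operation reads the last written version. -/
def SingleVersion : Prop :=
  (∀ t e f, e.IsWriteOn t → f.IsWriteOn t → (s.vlt e f ↔ s.lt e f)) ∧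
    ∀ a : Act 𝒯, (Act.op a).IsRead →
      ¬ ∃ e : Event 𝒯, e.IsWriteOn (Act.op a).target ∧ s.lt (s.vf a) e ∧ s.lt e (.act a)

/-- Single version serial schedules: in addition, transactions are not interleaved. -/
def SingleVersionSerial : Prop :=
  s.SingleVersion ∧
    ∀ i e f g, s.lt e f → s.lt f g → Event.InTxn e i → Event.InTxn g i → Event.InTxn f i

/-- Conflict equivalence of two schedules over the same set of transactions. -/
def ConflictEquivalent (s s' : Schedule 𝒯) : Prop :=
  ∀ b a : Act 𝒯, Conflict b a → (s.Dep b a ↔ s'.Dep b a)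

def ConflictSerializable : Prop :=
  ∃ s' : Schedule 𝒯, s'.SingleVersionSerial ∧ s.ConflictEquivalent s'

/-- Transactions `i` and `j` are concurrent. -/
def Concurrent (i j : Fin m) : Prop :=
  s.lt (first 𝒯 i) (.commit j) ∧ s.lt (first 𝒯 j) (.commit i)

/-- The write operation `a` respects the commit order. -/
def RespectsCommitOrder (a : Act 𝒯) : Prop :=
  ∀ b : Act 𝒯, (Act.op b).IsWrite → (Act.op b).target = (Act.op a).target → b.1 ≠ a.1 →
    (s.vlt (.act a) (.act b) ↔ s.lt (.commit a.1) (.commit b.1))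

/-- The read operation `a` is read-last-committed relative to the operation `e`. -/
def ReadLastCommitted (a : Act 𝒯) (e : Event 𝒯) : Prop :=
  (s.vf a = .init ∨ ∃ c : Act 𝒯, s.vf a = .act c ∧ s.lt (.commit c.1) e) ∧
    ¬ ∃ c : Act 𝒯, (Act.op c).IsWrite ∧ (Act.op c).target = (Act.op a).target ∧
      s.lt (.commit c.1) e ∧ s.vlt (s.vf a) (.act c)

/-- Transaction `j` exhibits a concurrent write. -/
def ExhibitsConcurrentWrite (j : Fin m) : Prop :=
  ∃ b a : Act 𝒯, (Act.op b).IsWrite ∧ (Act.op a).IsWrite ∧ (Act.op b).target = (Act.op a).target ∧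
    a.1 = j ∧ b.1 ≠ j ∧ s.lt (.act b) (.act a) ∧ s.lt (first 𝒯 j) (.commit b.1)

/-- Transaction `j` exhibits a dirty write. -/
def ExhibitsDirtyWrite (j : Fin m) : Prop :=
  ∃ b a : Act 𝒯, (Act.op b).IsWrite ∧ (Act.op a).IsWrite ∧ (Act.op b).target = (Act.op a).target ∧
    a.1 = j ∧ b.1 ≠ j ∧ s.lt (.act b) (.act a) ∧ s.lt (.act a) (.commit b.1)

/-- Transaction `i` is allowed under read committed. -/
def AllowedRC (i : Fin m) : Prop :=
  (∀ a : Act 𝒯, a.1 = i → (Act.op a).IsWrite → s.RespectsCommitOrder a) ∧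
  (∀ a : Act 𝒯, a.1 = i → (Act.op a).IsRead → s.ReadLastCommitted a (.act a)) ∧
  ¬ s.ExhibitsDirtyWrite i

/-- Transaction `i` is allowed under snapshot isolation. -/
def AllowedSI (i : Fin m) : Prop :=
  (∀ a : Act 𝒯, a.1 = i → (Act.op a).IsWrite → s.RespectsCommitOrder a) ∧
  (∀ a : Act 𝒯, a.1 = i → (Act.op a).IsRead → s.ReadLastCommitted a (first 𝒯 i)) ∧
  ¬ s.ExhibitsConcurrentWrite i

/-- There is an rw-antidependency from transaction `i` to transaction `j`. -/
def TxnRWDep (i j : Fin m) : Prop := ∃ b a : Act 𝒯, b.1 = i ∧ a.1 = j ∧ s.RWDep b a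

/-- The dangerous structure `i → j → k`. -/
def DangerousStructure (i j k : Fin m) : Prop :=
  s.TxnRWDep i j ∧ s.TxnRWDep j k ∧ s.Concurrent i j ∧ s.Concurrent j k ∧
    (k = i ∨ s.lt (.commit k) (.commit i)) ∧ s.lt (.commit k) (.commit j) ∧
    (ReadOnly 𝒯 i → s.lt (.commit k) (first 𝒯 i))

end Schedule

end Schedules

/-- Read committed, snapshot isolation, serializable snapshot isolation. -/
inductive IsoLevel
  | RC
  | SI
  | SSI

/-- Position of an isolation level in the order `RC < SI < SSI`. -/
def IsoLevel.rank : IsoLevel → ℕ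
  | .RC => 0
  | .SI => 1
  | .SSI => 2

theorem IsoLevel.rank_injective : Function.Injective IsoLevel.rank := by
  intro a b h
  cases a <;> cases b <;> simp_all [IsoLevel.rank]

/-- The total order `RC < SI < SSI`. -/
noncomputable instance : LinearOrder IsoLevel :=
  LinearOrder.lift' IsoLevel.rank IsoLevel.rank_injective

/-- The schedule `s` is allowed under the allocation `A`. -/
def Schedule.AllowedUnder {S : Schema} {m : ℕ} {𝒯 : TransactionSet S m} (s : Schedule 𝒯)
    (A : Fin m → IsoLevel) : Prop :=
  (∀ i, A i = .RC → s.AllowedRC i) ∧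
  (∀ i, A i = .SI ∨ A i = .SSI → s.AllowedSI i) ∧
  ¬ ∃ i j k, A i = .SSI ∧ A j = .SSI ∧ A k = .SSI ∧ s.DangerousStructure i j k

/-- Transaction robustness of `𝒯` against the allocation `A`. -/
def TransactionRobust {S : Schema} {m : ℕ} (𝒯 : TransactionSet S m) (A : Fin m → IsoLevel) : Prop :=
  ∀ s : Schedule 𝒯, s.AllowedUnder A → s.ConflictSerializable

/-- A template allocation for the set of templates `P`. -/
abbrev TemplateAllocation {S : Schema} (P : Set (Template S)) := P → IsoLevel

/-- `𝒯` is consistent with `P` and `D`. -/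
def ConsistentSet {S : Schema} {m : ℕ} (P : Set (Template S)) (D : Database S)
    (𝒯 : TransactionSet S m) : Prop :=
  ∀ i, ∃ τ ∈ P, InstantiatedFrom (𝒯 i) τ D

/-- The allocation `A` for `𝒯` is consistent with the template allocation `AP` and `D`. -/
def ConsistentAllocation {S : Schema} {m : ℕ} {P : Set (Template S)} (AP : TemplateAllocation P)
    (D : Database S) (𝒯 : TransactionSet S m) (A : Fin m → IsoLevel) : Prop :=
  ∀ i, ∃ τ : P, InstantiatedFrom (𝒯 i) τ D ∧ A i = AP τ

/-- `P` is robust against `AP` over the database `D`. -/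
def RobustOver {S : Schema} (P : Set (Template S)) (AP : TemplateAllocation P)
    (D : Database S) : Prop :=
  ∀ (m : ℕ) (𝒯 : TransactionSet S m), ConsistentSet P D 𝒯 →
    ∀ A : Fin m → IsoLevel, ConsistentAllocation AP D 𝒯 A → TransactionRobust 𝒯 A

/-- Template robustness of `P` against `AP`. -/
def Robust {S : Schema} (P : Set (Template S)) (AP : TemplateAllocation P) : Prop :=
  ∀ D : Database S, RobustOver P AP D

open Classical in
/-- The template allocation `AP[τ ↦ I]`. -/
noncomputable def TemplateAllocation.reassign {S : Schema} {P : Set (Template S)}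
    (AP : TemplateAllocation P) (τ : P) (I : IsoLevel) : TemplateAllocation P :=
  Function.update AP τ I

end TxnRobustness

/-! Part 1. In a schedule allowed under the higher levels, move every operation of an SI or SSI
transaction to the start of its transaction. Versions, commit order and dependencies do not change.
Each moved operation now sees the same commits as the first operation of its transaction, so RC and
SI make the same demands on these transactions and levels may be lowered (`exists_contracted`,
`TransactionRobust.mono`).

Part 2 holds for every allocation that picks, template by template, a level of `A₁` or of `A₂`. A
non-serializable schedule has a cycle of dependencies; take a shortest one, numbered so that no
transaction in it commits before `c 1`. Then `c 0 → c 1` is an antidependency against the commit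
order. Rearrange the cycle into a split schedule: a prefix of `c 0`, then `c 1, …, c (N - 1)`
serially, then the rest of `c 0`. The serial transactions can take any level, and a dangerous
structure must have `c 0` in the middle. If `c 0` is RC, the split schedule refutes the robust
allocation that gives RC to `c 0`. Otherwise all operations of `c 0` come first, and the split
schedule refutes `A₁` and `A₂` unless both assign SSI to `c 0`, `c 1` and `c (N - 1)`. In that case
`c (N - 1) → c 0 → c 1` is a forbidden dangerous structure of the given schedule.

The obstacle is that the prefix may write tuples that the other transactions write. Instances of
templates can be moved to fresh tuples, which leaves two tuples: `x`, on which `c 0` conflicts with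
`c 1`, and `y`, on which the cycle returns to `c 0`. Robustness forbids `c 0` to write `x`
(`Robust.not_isWrite_of_rwDep`, where nonempty write sets enter). The tuple `y` is renamed outside
the final stretch of conflicts on `y`, and within that stretch robustness again forbids the harmful
writes (`Robust.isWrite_of_reads_around`). -/

namespace TxnRobustness

/-! ### Conflicts, dependencies and single version serial schedules -/

section Operations

variable {S : Schema} {X : Type*} {type : X → S.Rel}

theorem Operation.isWrite_of_nonempty {o : Operation S X type} (h : o.writeSet.Nonempty) :
    o.IsWrite := by
  have := o.writeSet_of_read
  unfold Operation.IsWrite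
  cases hk : o.kind <;> simp_all

theorem Operation.isRead_of_nonempty {o : Operation S X type} (h : o.readSet.Nonempty) :
    o.IsRead := by
  have := o.readSet_of_write
  unfold Operation.IsRead
  cases hk : o.kind <;> simp_all

end Operations

section Schedules

variable {S : Schema} {m : ℕ} {𝒯 : TransactionSet S m}

namespace WWConflict

theorem isWrite_left {b a : Act 𝒯} (h : WWConflict b a) : (Act.op b).IsWrite :=
  Operation.isWrite_of_nonempty (h.2.mono Set.inter_subset_left)

theorem isWrite_right {b a : Act 𝒯} (h : WWConflict b a) : (Act.op a).IsWrite :=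
  Operation.isWrite_of_nonempty (h.2.mono Set.inter_subset_right)

theorem symm {b a : Act 𝒯} (h : WWConflict b a) : WWConflict a b :=
  ⟨⟨h.1.1.symm, h.1.2.symm⟩, by rw [Set.inter_comm]; exact h.2⟩

end WWConflict

namespace WRConflict

theorem isWrite {b a : Act 𝒯} (h : WRConflict b a) : (Act.op b).IsWrite :=
  Operation.isWrite_of_nonempty (h.2.mono Set.inter_subset_left)

theorem isRead {b a : Act 𝒯} (h : WRConflict b a) : (Act.op a).IsRead :=
  Operation.isRead_of_nonempty (h.2.mono Set.inter_subset_right)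

theorem symm {b a : Act 𝒯} (h : WRConflict b a) : RWConflict a b :=
  ⟨⟨h.1.1.symm, h.1.2.symm⟩, by rw [Set.inter_comm]; exact h.2⟩

end WRConflict

namespace RWConflict

theorem isRead {b a : Act 𝒯} (h : RWConflict b a) : (Act.op b).IsRead :=
  Operation.isRead_of_nonempty (h.2.mono Set.inter_subset_left)

theorem isWrite {b a : Act 𝒯} (h : RWConflict b a) : (Act.op a).IsWrite :=
  Operation.isWrite_of_nonempty (h.2.mono Set.inter_subset_right)

theorem symm {b a : Act 𝒯} (h : RWConflict b a) : WRConflict a b :=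
  ⟨⟨h.1.1.symm, h.1.2.symm⟩, by rw [Set.inter_comm]; exact h.2⟩

end RWConflict

theorem Conflict.ne {b a : Act 𝒯} (h : Conflict b a) : b.1 ≠ a.1 := by
  rcases h with h | h | h <;> exact h.1.1

theorem Conflict.target_eq {b a : Act 𝒯} (h : Conflict b a) :
    (Act.op b).target = (Act.op a).target := by
  rcases h with h | h | h <;> exact h.1.2

theorem Event.isWriteOn_act {a : Act 𝒯} {t : S.Obj} :
    (Event.act a).IsWriteOn t ↔ (Act.op a).IsWrite ∧ (Act.op a).target = t := by
  constructor
  · rintro ⟨b, hb, h⟩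
    cases hb
    exact h
  · exact fun h => ⟨a, rfl, h⟩

theorem Event.not_isWriteOn_init {t : S.Obj} : ¬ (Event.init : Event 𝒯).IsWriteOn t := by
  rintro ⟨b, hb, h⟩
  cases hb

theorem first_eq_act (a : Act 𝒯) : first 𝒯 a.1 = .act ⟨a.1, ⟨0, a.2.pos⟩⟩ := by
  unfold first
  rw [dif_pos a.2.pos]

namespace Schedule

variable (s : Schedule 𝒯)

theorem lt_asymm {e f : Event 𝒯} (h : s.lt e f) : ¬ s.lt f e :=
  fun h' => s.lt_irrefl _ (s.lt_trans _ _ _ h h')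

theorem act_lt_commit (a : Act 𝒯) : s.lt (.act a) (.commit a.1) :=
  s.txn_lt a.1 _ _ (.inr ⟨a.2, rfl, rfl⟩)

theorem first_eq_or_lt (a : Act 𝒯) : first 𝒯 a.1 = .act a ∨ s.lt (first 𝒯 a.1) (.act a) := by
  rw [first_eq_act]
  obtain ⟨i, k, hk⟩ := a
  rcases Nat.eq_zero_or_pos k with rfl | h
  · exact .inl rfl
  · exact .inr (s.txn_lt i _ _ (.inl ⟨_, _, h, rfl, rfl⟩))

theorem first_lt_commit (a : Act 𝒯) : s.lt (first 𝒯 a.1) (.commit a.1) := by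
  rcases s.first_eq_or_lt a with h | h
  · rw [h]
    exact s.act_lt_commit a
  · exact s.lt_trans _ _ _ h (s.act_lt_commit a)

/-- The version that `b` reads is below, equal to or above `a`, because the version order is total
on the writes of a tuple. -/
theorem rwDep_or_wrDep {b a : Act 𝒯} (h : RWConflict b a) : s.RWDep b a ∨ s.WRDep a b := by
  have hw : (Event.act a).IsWriteOn (Act.op b).target := ⟨a, rfl, h.isWrite, h.1.2.symm⟩
  rcases s.vf_write b h.isRead with hv | hv
  · exact .inl ⟨h, hv ▸ s.init_vlt _ _ hw⟩
  · by_cases he : s.vf b = .act a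
    · exact .inr ⟨h.symm, .inl he.symm⟩
    · rcases s.vlt_total _ _ _ hv hw he with h' | h'
      · exact .inl ⟨h, h'⟩
      · exact .inr ⟨h.symm, .inr h'⟩

theorem dep_or_dep {b a : Act 𝒯} (h : Conflict b a) : s.Dep b a ∨ s.Dep a b := by
  rcases h with h | h | h
  · have hw : (Event.act b).IsWriteOn (Act.op b).target := ⟨b, rfl, h.isWrite_left, rfl⟩
    have hw' : (Event.act a).IsWriteOn (Act.op b).target := ⟨a, rfl, h.isWrite_right, h.1.2.symm⟩
    have hne : Event.act b ≠ Event.act a := fun he => h.1.1 (by cases he; rfl)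
    rcases s.vlt_total _ _ _ hw hw' hne with h' | h'
    · exact .inl (.inl ⟨h, h'⟩)
    · exact .inr (.inl ⟨h.symm, h'⟩)
  · rcases s.rwDep_or_wrDep h.symm with h' | h'
    · exact .inr (.inr (.inr h'))
    · exact .inl (.inr (.inl h'))
  · rcases s.rwDep_or_wrDep h with h' | h'
    · exact .inl (.inr (.inr h'))
    · exact .inr (.inr (.inl h'))

variable {s}

theorem Dep.conflict {b a : Act 𝒯} (h : s.Dep b a) : Conflict b a := by
  rcases h with h | h | h
  · exact .inl h.1
  · exact .inr (.inl h.1)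
  · exact .inr (.inr h.1)

theorem SingleVersion.act_lt (hs : s.SingleVersion) {b a : Act 𝒯} (h : s.Dep b a) :
    s.lt (.act b) (.act a) := by
  obtain ⟨hv, hr⟩ := hs
  rcases h with ⟨hc, h⟩ | ⟨hc, h⟩ | ⟨hc, h⟩
  · exact (hv (Act.op b).target _ _ ⟨b, rfl, hc.isWrite_left, rfl⟩
      ⟨a, rfl, hc.isWrite_right, hc.1.2.symm⟩).1 h
  · have hlt := s.vf_lt a hc.isRead
    rcases h with h | h
    · exact h ▸ hlt
    · have hw : (s.vf a).IsWriteOn (Act.op a).target := by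
        rcases s.vf_write a hc.isRead with h' | h'
        · rw [h'] at h
          obtain ⟨t, -, ht⟩ := s.vlt_dom _ _ h
          exact absurd ht Event.not_isWriteOn_init
        · exact h'
      exact s.lt_trans _ _ _ ((hv _ _ _ ⟨b, rfl, hc.isWrite, hc.1.2⟩ hw).1 h) hlt
  · have hw : (Event.act a).IsWriteOn (Act.op b).target := ⟨a, rfl, hc.isWrite, hc.1.2.symm⟩
    have hne : Event.act b ≠ Event.act a := fun he => hc.1.1 (by cases he; rfl)
    -- If `a` came before `b`, it would lie strictly between `b` and the version that `b` reads.
    refine (s.lt_total _ _ hne).resolve_right fun hlt => hr b hc.isRead ⟨_, hw, ?_, hlt⟩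
    rcases s.vf_write b hc.isRead with h' | h'
    · rw [h']
      exact s.init_lt _ (by simp)
    · exact (hv _ _ _ h' hw).1 h

theorem SingleVersionSerial.commit_lt (hs : s.SingleVersionSerial) {b a : Act 𝒯}
    (h : s.Dep b a) : s.lt (.commit b.1) (.commit a.1) := by
  have hne := h.conflict.ne
  refine (s.lt_total _ _ (by simpa using hne)).resolve_right fun hlt => ?_
  have hab := hs.1.act_lt h
  rcases hs.2 b.1 (.act b) (.act a) (.commit b.1) hab
    (s.lt_trans _ _ _ (s.act_lt_commit a) hlt) (.inr ⟨b, rfl, rfl⟩) (.inl rfl) with h' | ⟨c, h', h''⟩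
  · cases h'
  · cases h'
    exact hne h''.symm

variable (s)

/-- Some operation of transaction `j` depends on an operation of transaction `i`. -/
def TxnDep (i j : Fin m) : Prop := ∃ b a : Act 𝒯, b.1 = i ∧ a.1 = j ∧ s.Dep b a

variable {s}

theorem TxnDep.ne {i j : Fin m} (h : s.TxnDep i j) : i ≠ j := by
  obtain ⟨b, a, rfl, rfl, h⟩ := h
  exact h.conflict.ne

theorem ConflictSerializable.not_transGen_self (hs : s.ConflictSerializable) (i : Fin m) :
    ¬ Relation.TransGen s.TxnDep i i := by
  obtain ⟨s', hs', he⟩ := hs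
  have key : ∀ j, Relation.TransGen s.TxnDep i j → s'.lt (.commit i) (.commit j) := by
    have step : ∀ j k, s.TxnDep j k → s'.lt (.commit j) (.commit k) := by
      rintro _ _ ⟨b, a, rfl, rfl, h⟩
      exact hs'.commit_lt ((he b a h.conflict).1 h)
    intro j h
    induction h with
    | single h => exact step _ _ h
    | tail _ h ih => exact s'.lt_trans _ _ _ ih (step _ _ h)
  exact fun h => s'.lt_irrefl _ (key i h)

end Schedule

/-! ### Schedules from total orders; serializability as acyclicity -/

/-- Every total order of the events that extends the orders of the transactions, together with a
visibility relation between writes and reads, underlies a schedule in which the version order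
follows the commit order and every read observes the last visible version. -/
theorem exists_schedule_of_key {K : Type*} [LinearOrder K] (key : Event 𝒯 → K)
    (hinj : Function.Injective key) (hinit : ∀ e, e ≠ .init → key .init < key e)
    (htxn : ∀ i e f, TxnLT i e f → key e < key f) (V : Act 𝒯 → Act 𝒯 → Prop)
    (hV : ∀ c a, V c a → key (.act c) < key (.act a)) :
    ∃ s : Schedule 𝒯, (∀ e f, s.lt e f ↔ key e < key f) ∧
      (∀ c d : Act 𝒯, s.vlt (.act c) (.act d) ↔ (Act.op c).IsWrite ∧ (Act.op d).IsWrite ∧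
        (Act.op c).target = (Act.op d).target ∧ (key (.commit c.1) < key (.commit d.1) ∨
          c.1 = d.1 ∧ key (.act c) < key (.act d))) ∧
      ∀ a : Act 𝒯, (s.vf a = .init ∧
          ∀ c : Act 𝒯, (Act.op c).IsWrite → (Act.op c).target = (Act.op a).target → ¬ V c a) ∨
        ∃ c : Act 𝒯, s.vf a = .act c ∧ V c a ∧
          ∀ d : Act 𝒯, (Act.op d).IsWrite → (Act.op d).target = (Act.op a).target → V d a →
            d = c ∨ s.vlt (.act d) (.act c) := by
  classical
  -- The second component orders the writes that one transaction makes on the same tuple.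
  let wkey : Act 𝒯 → K ×ₗ K := fun c => toLex (key (.commit c.1), key (.act c))
  have wlt : ∀ c d, wkey c < wkey d ↔ (key (.commit c.1) < key (.commit d.1) ∨
      c.1 = d.1 ∧ key (.act c) < key (.act d)) := by
    intro c d
    simp only [wkey, Prod.Lex.toLex_lt_toLex, hinj.eq_iff, Event.commit.injEq]
  have winj : Function.Injective wkey := by
    intro c d h
    have := congrArg (fun p => (ofLex p).2) h
    simpa [wkey, hinj.eq_iff] using this
  have hvf : ∀ a : Act 𝒯, ∃ v : Event 𝒯, (v = .init ∧
      ∀ c : Act 𝒯, (Act.op c).IsWrite → (Act.op c).target = (Act.op a).target → ¬ V c a) ∨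
        ∃ c : Act 𝒯, v = .act c ∧ (Act.op c).IsWrite ∧ (Act.op c).target = (Act.op a).target ∧
          V c a ∧ ∀ d : Act 𝒯, (Act.op d).IsWrite → (Act.op d).target = (Act.op a).target →
            V d a → wkey d ≤ wkey c := by
    intro a
    let F : Finset (Act 𝒯) := Finset.univ.filter fun c =>
      (Act.op c).IsWrite ∧ (Act.op c).target = (Act.op a).target ∧ V c a
    rcases F.eq_empty_or_nonempty with hF | hF
    · refine ⟨.init, .inl ⟨rfl, fun c h1 h2 h3 => ?_⟩⟩
      have : c ∈ F := by simp [F, h1, h2, h3]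
      simp [hF] at this
    · obtain ⟨c, hc, hmax⟩ := F.exists_max_image wkey hF
      simp only [F, Finset.mem_filter, Finset.mem_univ, true_and] at hc hmax
      exact ⟨.act c, .inr ⟨c, rfl, hc.1, hc.2.1, hc.2.2, fun d h1 h2 h3 => hmax d ⟨h1, h2, h3⟩⟩⟩
  choose vf hvf using hvf
  let s : Schedule 𝒯 :=
    { lt := fun e f => key e < key f
      vlt := fun e f => ∃ d : Act 𝒯, f = .act d ∧ (Act.op d).IsWrite ∧ (e = .init ∨
        ∃ c : Act 𝒯, e = .act c ∧ (Act.op c).IsWrite ∧ (Act.op c).target = (Act.op d).target ∧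
          wkey c < wkey d)
      vf := vf
      lt_irrefl := fun e => lt_irrefl _
      lt_trans := fun e f g => lt_trans
      lt_total := fun e f h => lt_or_gt_of_ne (hinj.ne h)
      init_lt := hinit
      txn_lt := htxn
      vlt_dom := by
        rintro e f ⟨d, rfl, hd, rfl | ⟨c, rfl, hc, ht, -⟩⟩
        · exact ⟨_, .inl rfl, d, rfl, hd, rfl⟩
        · exact ⟨_, .inr ⟨c, rfl, hc, ht⟩, d, rfl, hd, rfl⟩
      vlt_irrefl := by
        rintro e ⟨d, rfl, hd, h | ⟨c, h, hc, ht, hlt⟩⟩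
        · cases h
        · cases h
          exact lt_irrefl _ hlt
      vlt_trans := by
        rintro e f g ⟨d, rfl, hd, h⟩ ⟨d', rfl, hd', h' | ⟨c', h', hc', ht', hlt'⟩⟩
        · cases h'
        · cases h'
          refine ⟨d', rfl, hd', ?_⟩
          rcases h with h | ⟨c, h, hc, ht, hlt⟩
          · exact .inl h
          · exact .inr ⟨c, h, hc, ht.trans ht', hlt.trans hlt'⟩
      vlt_total := by
        rintro t e f ⟨c, rfl, hc, rfl⟩ ⟨d, rfl, hd, ht⟩ hne
        have hcd : c ≠ d := fun h => hne (by rw [h])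
        rcases lt_or_gt_of_ne (winj.ne hcd) with h | h
        · exact .inl ⟨d, rfl, hd, .inr ⟨c, rfl, hc, ht.symm, h⟩⟩
        · exact .inr ⟨c, rfl, hc, .inr ⟨d, rfl, hd, ht, h⟩⟩
      init_vlt := by
        rintro t e ⟨c, rfl, hc, rfl⟩
        exact ⟨c, rfl, hc, .inl rfl⟩
      vf_lt := by
        intro a _
        rcases hvf a with ⟨h, -⟩ | ⟨c, h, -, -, hv, -⟩
        · rw [h]
          exact hinit _ (by simp)
        · rw [h]
          exact hV _ _ hv
      vf_write := by
        intro a _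
        rcases hvf a with ⟨h, -⟩ | ⟨c, h, hc, ht, -⟩
        · exact .inl h
        · exact .inr ⟨c, h, hc, ht⟩ }
  have hs : ∀ c d : Act 𝒯, s.vlt (.act c) (.act d) ↔ (Act.op c).IsWrite ∧ (Act.op d).IsWrite ∧
        (Act.op c).target = (Act.op d).target ∧ wkey c < wkey d := by
    intro c d
    constructor
    · rintro ⟨d', h, hd, h' | ⟨c', h', hc, ht, hlt⟩⟩
      · cases h'
      · cases h
        cases h'
        exact ⟨hc, hd, ht, hlt⟩
    · rintro ⟨hc, hd, ht, hlt⟩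
      exact ⟨d, rfl, hd, .inr ⟨c, rfl, hc, ht, hlt⟩⟩
  refine ⟨s, fun e f => Iff.rfl, fun c d => by rw [hs, wlt], fun a => ?_⟩
  rcases hvf a with ⟨h, h'⟩ | ⟨c, h, hc, ht, hv, hmax⟩
  · exact .inl ⟨h, h'⟩
  · refine .inr ⟨c, h, hv, fun d hd hdt hdv => ?_⟩
    rcases (hmax d hd hdt hdv).eq_or_lt with h' | h'
    · exact .inl (winj h')
    · exact .inr ((hs d c).2 ⟨hd, hc, hdt.trans ht.symm, h'⟩)

/-- Transactions can be executed serially in any order. -/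
theorem exists_singleVersionSerial {α : Type*} [LinearOrder α] (f : Fin m → α)
    (hf : Function.Injective f) : ∃ s : Schedule 𝒯, s.SingleVersionSerial ∧
      ∀ i j, s.lt (.commit i) (.commit j) ↔ f i < f j := by
  -- Transactions are sorted by `f`, and by position inside. The length serves as the position of
  -- the commit, past all operations.
  let key : Event 𝒯 → WithBot α ×ₗ ℕ := fun e => match e with
    | .init => toLex (⊥, 0)
    | .act a => toLex (f a.1, a.2.val)
    | .commit i => toLex (f i, (𝒯 i).length)
  have key_inj : Function.Injective key := by
    rintro (_ | ⟨i, k⟩ | i) (_ | ⟨j, l⟩ | j) h <;>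
      simp only [key, toLex_inj, Prod.mk.injEq, WithBot.coe_inj, hf.eq_iff] at h
    · rfl
    · exact absurd h.1 (by simp)
    · exact absurd h.1 (by simp)
    · exact absurd h.1 (by simp)
    · obtain ⟨rfl, h⟩ := h
      rw [Fin.ext h]
    · obtain ⟨rfl, h⟩ := h
      exact absurd h k.2.ne
    · exact absurd h.1 (by simp)
    · obtain ⟨rfl, h⟩ := h
      exact absurd h.symm l.2.ne
    · rw [h.1]
  have key_txn : ∀ i e f, TxnLT i e f → key e < key f := by
    rintro i e f (⟨k, l, h, rfl, rfl⟩ | ⟨k, rfl, rfl⟩)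
    · simpa [key, Prod.Lex.toLex_lt_toLex] using h
    · simp [key, Prod.Lex.toLex_lt_toLex]
  obtain ⟨s, hlt, hvlt, hvf⟩ := exists_schedule_of_key key key_inj
    (by rintro (_ | ⟨i, k⟩ | i) h <;> simp_all [key, Prod.Lex.toLex_lt_toLex]) key_txn
    (fun c a => key (.act c) < key (.act a)) (fun c a h => h)
  -- In a serial order, following the commits and following the operations themselves give the same
  -- version order.
  have act_lt : ∀ c d : Act 𝒯, key (.act c) < key (.act d) ↔
      (key (.commit c.1) < key (.commit d.1) ∨ c.1 = d.1 ∧ key (.act c) < key (.act d)) := by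
    rintro ⟨i, k⟩ ⟨j, l⟩
    simp only [key, Prod.Lex.toLex_lt_toLex, WithBot.coe_lt_coe, WithBot.coe_inj, hf.eq_iff]
    constructor
    · rintro (h | ⟨rfl, h⟩)
      · exact .inl (.inl h)
      · exact .inr ⟨rfl, .inr ⟨rfl, h⟩⟩
    · rintro ((h | ⟨rfl, h⟩) | ⟨rfl, h⟩)
      · exact .inl h
      · exact absurd h (lt_irrefl _)
      · exact h
  refine ⟨s, ⟨⟨?_, ?_⟩, ?_⟩, fun i j => ?_⟩
  · rintro t e f ⟨c, rfl, hc, rfl⟩ ⟨d, rfl, hd, ht⟩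
    rw [hvlt, hlt, ← act_lt]
    simp [hc, hd, ht]
  · rintro a - ⟨e, ⟨d, rfl, hd, ht⟩, h1, h2⟩
    rw [hlt] at h1 h2
    rcases hvf a with ⟨h, h'⟩ | ⟨c, h, hc, hmax⟩
    · exact h' d hd ht h2
    · rw [h] at h1
      rcases hmax d hd ht h2 with h' | h'
      · rw [h'] at h1
        exact lt_irrefl _ h1
      · rw [hvlt, ← act_lt] at h'
        exact lt_asymm h1 h'.2.2.2
  · intro i e g h hef hgh hei hhi
    have hfst : ∀ e : Event 𝒯, e.InTxn i → (ofLex (key e)).1 = f i := by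
      rintro e (rfl | ⟨a, rfl, rfl⟩) <;> rfl
    have hmono : ∀ e f, s.lt e f → (ofLex (key e)).1 ≤ (ofLex (key f)).1 := by
      intro e f hef
      rw [hlt, Prod.Lex.lt_iff] at hef
      rcases hef with h | h
      · exact h.le
      · exact h.1.le
    have h1 := hmono _ _ hef
    have h2 := hmono _ _ hgh
    rw [hfst e hei] at h1
    rw [hfst h hhi] at h2
    have h3 := le_antisymm h2 h1
    rcases g with _ | a | j
    · simp [key] at h3
    · exact .inr ⟨a, rfl, hf (by simpa [key] using h3)⟩
    · exact .inl (by rw [hf (by simpa [key] using h3 : f j = f i)])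
  · rw [hlt]
    simp only [key, Prod.Lex.toLex_lt_toLex, WithBot.coe_lt_coe, WithBot.coe_inj, hf.eq_iff]
    constructor
    · rintro (h | ⟨rfl, h⟩)
      · exact h
      · exact absurd h (lt_irrefl _)
    · exact .inl

/-- Run the transactions serially by their rank in the dependency relation, with ties broken by id.
Dependencies of both schedules then follow the same commit order, and each conflict is oriented in
both schedules, hence in the same way. -/
theorem Schedule.conflictSerializable_of_wellFounded (s : Schedule 𝒯)
    (hwf : WellFounded s.TxnDep) : s.ConflictSerializable := by
  have : IsWellFounded (Fin m) s.TxnDep := ⟨hwf⟩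
  obtain ⟨s', hs', hlt⟩ := exists_singleVersionSerial (𝒯 := 𝒯)
    (fun i : Fin m => toLex (IsWellFounded.rank s.TxnDep i, i)) (fun i j h => congrArg (fun p => (ofLex p).2) h)
  have key : ∀ b a, s.Dep b a → s'.lt (.commit b.1) (.commit a.1) := by
    intro b a h
    rw [hlt, Prod.Lex.toLex_lt_toLex]
    exact .inl (IsWellFounded.rank_lt_of_rel ⟨b, a, rfl, rfl, h⟩)
  refine ⟨s', hs', fun b a hc => ⟨fun h => ?_, fun h => ?_⟩⟩
  · exact (s'.dep_or_dep hc).resolve_right fun h' =>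
      s'.lt_asymm (key _ _ h) (hs'.commit_lt h')
  · exact (s.dep_or_dep hc).resolve_right fun h' =>
      s'.lt_asymm (hs'.commit_lt h) (key _ _ h')

end Schedules

/-! ### Chordless cycles -/

/-- A relation on a finite type that is not well founded has a chordless cycle. -/
theorem exists_minimal_cycle {α : Type*} [Finite α] {r : α → α → Prop} (h : ¬ WellFounded r) :
    ∃ (n : ℕ) (c : ℕ → α), 0 < n ∧ (∀ i, c (i + n) = c i) ∧ (∀ i, r (c i) (c (i + 1))) ∧
      ∀ i l, i ≤ l → r (c l) (c i) → n + i ≤ l + 1 := by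
  classical
  -- A stretch from `c i` to `c l` with an edge back to `c i` is repeated with period `l + 1 - i`.
  -- Applied to a chord, this contradicts the minimal period.
  have cycle : ∀ (c : ℕ → α) (i l : ℕ), i ≤ l → (∀ j, i ≤ j → j < l → r (c j) (c (j + 1))) →
      r (c l) (c i) → ∃ c' : ℕ → α, (∀ j, c' (j + (l + 1 - i)) = c' j) ∧
        ∀ j, r (c' j) (c' (j + 1)) := by
    intro c i l hil hc hr
    refine ⟨fun j => c (i + j % (l + 1 - i)), fun j => by simp, fun j => ?_⟩
    have hlt := Nat.mod_lt j (show 0 < l + 1 - i by omega)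
    rcases Nat.lt_or_ge (j % (l + 1 - i) + 1) (l + 1 - i) with h | h
    · have : (j + 1) % (l + 1 - i) = j % (l + 1 - i) + 1 := by
        rw [Nat.add_mod, Nat.mod_eq_of_lt (show 1 < l + 1 - i by omega), Nat.mod_eq_of_lt h]
      simp only [this, ← add_assoc]
      exact hc _ (by omega) (by omega)
    · have hj : j % (l + 1 - i) = l - i := by omega
      have : (j + 1) % (l + 1 - i) = 0 := by
        rw [Nat.add_mod, hj]
        rcases Nat.eq_or_lt_of_le hil with rfl | h'
        · simp
        · rw [Nat.mod_eq_of_lt (show 1 < l + 1 - i by omega),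
            show l - i + 1 = l + 1 - i by omega, Nat.mod_self]
      simp only [this, hj]
      rw [show i + (l - i) = l by omega]
      exact hr
  have hex : ∃ n, 0 < n ∧ ∃ c : ℕ → α, (∀ i, c (i + n) = c i) ∧ ∀ i, r (c i) (c (i + 1)) := by
    rw [wellFounded_iff_isEmpty_descending_chain, not_isEmpty_iff] at h
    obtain ⟨f, hf⟩ := h
    obtain ⟨i, j, hij, he⟩ := Finite.exists_ne_map_eq_of_infinite f
    wlog hlt : i < j generalizing i j
    · exact this j i hij.symm he.symm (by omega)
    -- The infinite chain is descending, so its stretch between two equal values is traversed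
    -- backwards.
    obtain ⟨c, h1, h2⟩ := cycle (fun k => f (j - k)) 0 (j - i - 1) (by omega)
      (fun k _ hk => by
        have := hf (j - (k + 1))
        rwa [show j - (k + 1) + 1 = j - k by omega] at this)
      (by
        have := hf i
        simp only [show j - (j - i - 1) = i + 1 by omega, Nat.sub_zero]
        rwa [← he])
    exact ⟨_, by omega, c, h1, h2⟩
  obtain ⟨hn, c, h1, h2⟩ := Nat.find_spec hex
  refine ⟨Nat.find hex, c, hn, h1, h2, fun i l hil hr => ?_⟩
  obtain ⟨c', h3, h4⟩ := cycle c i l hil (fun j _ _ => h2 j) hr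
  have := Nat.find_min' hex ⟨by omega, c', h3, h4⟩
  omega

/-! ### Snapshots, and raising the levels of transactions -/

section Allowed

variable {S : Schema} {m : ℕ} {𝒯 : TransactionSet S m}

/-- The event relative to which the isolation level of its transaction makes the operation `a`
observe the last committed versions. -/
noncomputable def snapshot (A : Fin m → IsoLevel) (a : Act 𝒯) : Event 𝒯 :=
  if A a.1 = .RC then .act a else first 𝒯 a.1

theorem snapshot_of_eq {A : Fin m → IsoLevel} {a : Act 𝒯} (h : A a.1 = .RC) :
    snapshot A a = .act a := if_pos h

theorem snapshot_of_ne {A : Fin m → IsoLevel} {a : Act 𝒯} (h : A a.1 ≠ .RC) :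
    snapshot A a = first 𝒯 a.1 := if_neg h

theorem snapshot_eq_act (A : Fin m → IsoLevel) (a : Act 𝒯) :
    ∃ k, snapshot A a = .act ⟨a.1, k⟩ ∧ k ≤ a.2 := by
  by_cases h : A a.1 = .RC
  · exact ⟨a.2, snapshot_of_eq h, le_rfl⟩
  · exact ⟨⟨0, a.2.pos⟩, (snapshot_of_ne h).trans (first_eq_act a), Nat.zero_le _⟩

namespace Schedule

variable {s : Schedule 𝒯} {A : Fin m → IsoLevel}

theorem snapshot_lt_commit (s : Schedule 𝒯) (A : Fin m → IsoLevel) (a : Act 𝒯) :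
    s.lt (snapshot A a) (.commit a.1) := by
  obtain ⟨k, h, -⟩ := snapshot_eq_act A a
  rw [h]
  exact s.act_lt_commit ⟨a.1, k⟩

theorem snapshot_ne_commit (A : Fin m → IsoLevel) (a : Act 𝒯) (i : Fin m) :
    snapshot A a ≠ .commit i := by
  obtain ⟨k, h, -⟩ := snapshot_eq_act A a
  simp [h]

theorem lt_commit_of_not (s : Schedule 𝒯) {A : Fin m → IsoLevel} {a : Act 𝒯} {i : Fin m}
    (h : ¬ s.lt (.commit i) (snapshot A a)) : s.lt (snapshot A a) (.commit i) :=
  (s.lt_total _ _ (snapshot_ne_commit A a i)).resolve_right h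

/-- A later snapshot in the same transaction can only occur under read committed. -/
theorem eq_RC_of_snapshot_lt {a b : Act 𝒯} (hab : a.1 = b.1)
    (h : s.lt (snapshot A a) (snapshot A b)) : A a.1 = .RC ∧ a.2.val < b.2.val := by
  by_cases hA : A a.1 = .RC
  · refine ⟨hA, ?_⟩
    rw [snapshot_of_eq hA, snapshot_of_eq (hab ▸ hA)] at h
    obtain ⟨i, k⟩ := a
    obtain ⟨j, l⟩ := b
    obtain rfl : i = j := hab
    by_contra! hle
    rcases hle.eq_or_lt with he | hlt
    · obtain rfl : l = k := Fin.ext he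
      exact s.lt_irrefl _ h
    · exact s.lt_asymm h (s.txn_lt i _ _ (.inl ⟨_, _, hlt, rfl, rfl⟩))
  · rw [snapshot_of_ne hA, snapshot_of_ne (hab ▸ hA), hab] at h
    exact absurd h (s.lt_irrefl _)

namespace AllowedUnder

theorem allowed (h : s.AllowedUnder A) (i : Fin m) :
    A i = .RC ∧ s.AllowedRC i ∨ A i ≠ .RC ∧ s.AllowedSI i := by
  cases hA : A i
  · exact .inl ⟨rfl, h.1 i hA⟩
  · exact .inr ⟨by simp, h.2.1 i (.inl hA)⟩
  · exact .inr ⟨by simp, h.2.1 i (.inr hA)⟩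

theorem respectsCommitOrder (h : s.AllowedUnder A) {a : Act 𝒯} (ha : (Act.op a).IsWrite) :
    s.RespectsCommitOrder a := by
  rcases h.allowed a.1 with ⟨-, h⟩ | ⟨-, h⟩
  · exact h.1 a rfl ha
  · exact h.1 a rfl ha

theorem readLastCommitted (h : s.AllowedUnder A) {a : Act 𝒯} (ha : (Act.op a).IsRead) :
    s.ReadLastCommitted a (snapshot A a) := by
  rcases h.allowed a.1 with ⟨hA, h⟩ | ⟨hA, h⟩
  · rw [snapshot_of_eq hA]
    exact h.2.1 a rfl ha
  · rw [snapshot_of_ne hA]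
    exact h.2.1 a rfl ha

theorem commit_lt_of_wwDep (h : s.AllowedUnder A) {b a : Act 𝒯} (hd : s.WWDep b a) :
    s.lt (.commit b.1) (.commit a.1) :=
  (h.respectsCommitOrder hd.1.isWrite_left a hd.1.isWrite_right hd.1.1.2.symm
    hd.1.1.1.symm).1 hd.2

/-- The version that is read was committed before the snapshot, and older versions were committed
even earlier, because versions follow the commit order. -/
theorem commit_lt_snapshot_of_wrDep (h : s.AllowedUnder A) {b a : Act 𝒯} (hd : s.WRDep b a) :
    s.lt (.commit b.1) (snapshot A a) := by
  obtain ⟨hc, hd⟩ := hd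
  rcases (h.readLastCommitted hc.isRead).1 with hv | ⟨c, hv, hlt⟩
  · rw [hv] at hd
    rcases hd with hd | hd
    · cases hd
    · obtain ⟨t, -, ht⟩ := s.vlt_dom _ _ hd
      exact absurd ht Event.not_isWriteOn_init
  · rw [hv] at hd
    rcases hd with hd | hd
    · cases hd
      exact hlt
    · by_cases hbc : c.1 = b.1
      · rwa [hbc] at hlt
      · obtain ⟨t, hb, ht⟩ := s.vlt_dom _ _ hd
        have hb := hb.resolve_left (by simp)
        rw [Event.isWriteOn_act] at hb ht
        exact s.lt_trans _ _ _ ((h.respectsCommitOrder hb.1 c ht.1 (ht.2.trans hb.2.symm)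
          hbc).1 hd) hlt

/-- Otherwise the read would have ignored a newer version that was already committed. -/
theorem snapshot_lt_commit_of_rwDep (h : s.AllowedUnder A) {b a : Act 𝒯} (hd : s.RWDep b a) :
    s.lt (snapshot A b) (.commit a.1) :=
  s.lt_commit_of_not fun hlt => (h.readLastCommitted hd.1.isRead).2
    ⟨a, hd.1.isWrite, hd.1.1.2.symm, hlt, hd.2⟩

/-- If two transactions write the same tuple, then one of them commits before the snapshot that
the other one uses. -/
theorem commit_lt_snapshot_of_isWrite (h : s.AllowedUnder A) {b a : Act 𝒯}
    (hb : (Act.op b).IsWrite) (ha : (Act.op a).IsWrite)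
    (ht : (Act.op b).target = (Act.op a).target) (hne : b.1 ≠ a.1) :
    s.lt (.commit b.1) (snapshot A a) ∨ s.lt (.commit a.1) (snapshot A b) := by
  wlog hlt : s.lt (.act b) (.act a) generalizing a b
  · exact (this ha hb ht.symm hne.symm ((s.lt_total _ _ fun he => hne
      (by cases he; rfl)).resolve_left hlt)).symm
  refine .inl ?_
  -- If the earlier writer is still active at the snapshot of the later one, the later one exhibits
  -- a dirty write (RC) or a concurrent write (SI).
  by_contra hn
  have hlt' := s.lt_commit_of_not hn
  rcases h.allowed a.1 with ⟨hA, h⟩ | ⟨hA, h⟩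
  · rw [snapshot_of_eq hA] at hlt'
    exact h.2.2 ⟨b, a, hb, ha, ht, rfl, hne, hlt, hlt'⟩
  · rw [snapshot_of_ne hA] at hlt'
    exact h.2.2 ⟨b, a, hb, ha, ht, rfl, hne, hlt, hlt'⟩

theorem not_commit_lt_snapshot_of_dep (h : s.AllowedUnder A) {b a : Act 𝒯} (hd : s.Dep b a) :
    ¬ s.lt (.commit a.1) (snapshot A b) := by
  intro hlt
  have hb := s.lt_trans _ _ _ hlt (s.snapshot_lt_commit A b)
  rcases hd with hd | hd | hd
  · exact s.lt_asymm hb (h.commit_lt_of_wwDep hd)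
  · exact s.lt_asymm hb (s.lt_trans _ _ _ (h.commit_lt_snapshot_of_wrDep hd)
      (s.snapshot_lt_commit A a))
  · exact s.lt_asymm hlt (h.snapshot_lt_commit_of_rwDep hd)

end AllowedUnder

/-- Moving all operations of the transactions under (serializable) snapshot isolation to the start
of their transaction. -/
theorem exists_contracted (s : Schedule 𝒯) (A : Fin m → IsoLevel) (h : s.AllowedUnder A) :
    ∃ s' : Schedule 𝒯, s'.vlt = s.vlt ∧ s'.vf = s.vf ∧
      (∀ i j, s'.lt (.commit i) (.commit j) ↔ s.lt (.commit i) (.commit j)) ∧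
      (∀ i j, s'.lt (first 𝒯 i) (.commit j) ↔ s.lt (first 𝒯 i) (.commit j)) ∧
      (∀ i j, s'.lt (.commit j) (first 𝒯 i) ↔ s.lt (.commit j) (first 𝒯 i)) ∧
      ∀ i (a : Act 𝒯), s'.lt (.commit i) (.act a) ↔ s.lt (.commit i) (snapshot A a) := by
  let rep : Event 𝒯 → Event 𝒯 := fun e => match e with
    | .init => .init
    | .act a => snapshot A a
    | .commit i => .commit i
  -- Only operations with the same snapshot need a tie-break, since no snapshot is a commit or
  -- `op₀`; the default value is immaterial.
  let pos : Event 𝒯 → ℕ := fun e => match e with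
    | .act a => a.2
    | _ => 0
  have rep_inj : ∀ e f, rep e = rep f → pos e = pos f → e = f := by
    rintro (_ | ⟨i, k⟩ | i) (_ | ⟨j, l⟩ | j) h hp <;> simp only [rep, pos] at h hp
    · rfl
    · obtain ⟨k, hk, -⟩ := snapshot_eq_act A ⟨j, l⟩
      simp [hk] at h
    · cases h
    · obtain ⟨k, hk, -⟩ := snapshot_eq_act A ⟨i, k⟩
      simp [hk] at h
    · obtain ⟨k', hk, -⟩ := snapshot_eq_act A ⟨i, k⟩
      obtain ⟨l', hl, -⟩ := snapshot_eq_act A ⟨j, l⟩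
      rw [hk, hl] at h
      obtain rfl : i = j := by cases h; rfl
      rw [Fin.ext hp]
    · exact absurd h (snapshot_ne_commit _ _ _)
    · cases h
    · exact absurd h.symm (snapshot_ne_commit _ _ _)
    · exact h
  have rep_first : ∀ i, rep (first 𝒯 i) = first 𝒯 i := by
    intro i
    by_cases hi : 0 < (𝒯 i).length
    · have hf := first_eq_act (𝒯 := 𝒯) ⟨i, ⟨0, hi⟩⟩
      by_cases hA : A i = .RC
      · simpa only [hf] using snapshot_of_eq (a := ⟨i, ⟨0, hi⟩⟩) hA
      · have := snapshot_of_ne (𝒯 := 𝒯) (a := ⟨i, ⟨0, hi⟩⟩) hA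
        simpa only [hf] using this
    · simp [first, hi, rep]
  have rep_txn : ∀ i e f, TxnLT i e f → s.lt (rep e) (rep f) ∨ rep e = rep f ∧ pos e < pos f := by
    rintro i e f (⟨k, l, h, rfl, rfl⟩ | ⟨k, rfl, rfl⟩)
    · by_cases hA : A i = .RC
      · refine .inl ?_
        simp only [rep, snapshot_of_eq (𝒯 := 𝒯) (a := ⟨i, k⟩) hA,
          snapshot_of_eq (𝒯 := 𝒯) (a := ⟨i, l⟩) hA]
        exact s.txn_lt i _ _ (.inl ⟨k, l, h, rfl, rfl⟩)
      · refine .inr ⟨?_, h⟩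
        simp only [rep, snapshot_of_ne (𝒯 := 𝒯) (a := ⟨i, k⟩) hA,
          snapshot_of_ne (𝒯 := 𝒯) (a := ⟨i, l⟩) hA]
    · exact .inl (s.snapshot_lt_commit A ⟨i, k⟩)
  let s' : Schedule 𝒯 :=
    { lt := fun e f => s.lt (rep e) (rep f) ∨ rep e = rep f ∧ pos e < pos f
      vlt := s.vlt
      vf := s.vf
      lt_irrefl := by
        rintro e (h | ⟨-, h⟩)
        · exact s.lt_irrefl _ h
        · exact Nat.lt_irrefl _ h
      lt_trans := by
        rintro e f g (h | ⟨h, hp⟩) (h' | ⟨h', hp'⟩)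
        · exact .inl (s.lt_trans _ _ _ h h')
        · exact .inl (h' ▸ h)
        · exact .inl (h ▸ h')
        · exact .inr ⟨h.trans h', hp.trans hp'⟩
      lt_total := by
        intro e f hne
        by_cases h : rep e = rep f
        · rcases lt_trichotomy (pos e) (pos f) with hp | hp | hp
          · exact .inl (.inr ⟨h, hp⟩)
          · exact absurd (rep_inj e f h hp) hne
          · exact .inr (.inr ⟨h.symm, hp⟩)
        · exact (s.lt_total _ _ h).imp .inl .inl
      init_lt := by
        intro e he
        refine .inl (s.init_lt _ fun h => he ?_)
        rcases e with _ | a | i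
        · rfl
        · obtain ⟨k, hk, -⟩ := snapshot_eq_act A a
          simp [rep, hk] at h
        · cases h
      txn_lt := rep_txn
      vlt_dom := s.vlt_dom
      vlt_irrefl := s.vlt_irrefl
      vlt_trans := s.vlt_trans
      vlt_total := s.vlt_total
      init_vlt := s.init_vlt
      -- The transaction of the version that is read committed before the snapshot, so its moved
      -- write also precedes the moved read.
      vf_lt := by
        intro a ha
        refine .inl ?_
        rcases (h.readLastCommitted ha).1 with hv | ⟨c, hv, hlt⟩
        · rw [hv]
          obtain ⟨k, hk, -⟩ := snapshot_eq_act A a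
          exact s.init_lt _ (by simp [rep, hk])
        · rw [hv]
          exact s.lt_trans _ _ _ (s.snapshot_lt_commit A c) hlt
      vf_write := s.vf_write }
  have hs' : ∀ e f, s'.lt e f ↔ (s.lt (rep e) (rep f) ∨ rep e = rep f ∧ pos e < pos f) :=
    fun _ _ => Iff.rfl
  have pos_first : ∀ i, pos (first 𝒯 i) = 0 := by
    intro i
    unfold first
    split_ifs <;> rfl
  refine ⟨s', rfl, rfl, fun i j => ?_, fun i j => ?_, fun i j => ?_, fun i a => ?_⟩
  · simp [hs', rep, pos]
  · simp only [hs', rep_first, pos_first]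
    simp [rep, pos]
  · simp only [hs', rep_first, pos_first]
    simp [rep, pos]
  · simp only [hs', rep, pos, (snapshot_ne_commit A a i).symm, false_and, or_false]

end Schedule

/-- The contracted schedule is allowed under the lower levels: a transaction that stays at RC under
`A` meets RC as before, the others meet RC and SI alike, and an SSI transaction under `A'` is SSI
under `A`, so no new dangerous structure has to be excluded. -/
theorem TransactionRobust.mono {A A' : Fin m → IsoLevel} (hle : A' ≤ A)
    (hR : TransactionRobust 𝒯 A') : TransactionRobust 𝒯 A := by
  intro s h
  have hRC : ∀ i, A i = .RC → A' i = .RC := by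
    intro i hi
    have : (A' i).rank ≤ (A i).rank := hle i
    cases h' : A' i <;> simp_all [IsoLevel.rank]
  have hSSI : ∀ i, A' i = .SSI → A i = .SSI := by
    intro i hi
    have : (A' i).rank ≤ (A i).rank := hle i
    cases h' : A i <;> simp_all [IsoLevel.rank]
  obtain ⟨s', hv, hf, hcc, hfc, hcf, hca⟩ := s.exists_contracted A h
  have hdep : ∀ b a, s'.Dep b a ↔ s.Dep b a := by
    intro b a
    simp only [Schedule.Dep, Schedule.WWDep, Schedule.WRDep, Schedule.RWDep, hv, hf]
  have hrw : ∀ i j, s'.TxnRWDep i j ↔ s.TxnRWDep i j := by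
    intro i j
    simp only [Schedule.TxnRWDep, Schedule.RWDep, hv, hf]
  have hrespect : ∀ a : Act 𝒯, (Act.op a).IsWrite → s'.RespectsCommitOrder a := by
    intro a ha b hb ht hne
    rw [hv, hcc]
    exact h.respectsCommitOrder ha b hb ht hne
  have hread : ∀ (a : Act 𝒯) (e : Event 𝒯), (Act.op a).IsRead →
      (∀ i, s'.lt (.commit i) e ↔ s.lt (.commit i) (snapshot A a)) → s'.ReadLastCommitted a e := by
    intro a e ha he
    simp only [Schedule.ReadLastCommitted, he, hv, hf]
    exact h.readLastCommitted ha
  have hwrite : ∀ b a : Act 𝒯, (Act.op b).IsWrite → (Act.op a).IsWrite →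
      (Act.op b).target = (Act.op a).target → b.1 ≠ a.1 → s'.lt (.act b) (.act a) →
      s'.lt (.commit b.1) (.act a) := by
    intro b a hb ha ht hne hlt
    rcases h.commit_lt_snapshot_of_isWrite hb ha ht hne with h' | h'
    · exact (hca _ _).2 h'
    · exact absurd (s'.lt_trans _ _ _ ((hca _ _).2 h') hlt) (s'.lt_asymm (s'.act_lt_commit a))
  have hs' : s'.AllowedUnder A' := by
    refine ⟨fun i hi => ⟨fun a _ ha => hrespect a ha, fun a _ ha => hread a _ ha
      fun j => hca j a, ?_⟩, fun i hi => ?_, ?_⟩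
    · rintro ⟨b, a, hb, ha, ht, rfl, hne, hlt, hlt'⟩
      exact s'.lt_asymm hlt' (hwrite b a hb ha ht hne hlt)
    · have hA : A i ≠ .RC := by
        intro hA
        rcases hi with hi | hi <;> simp [hRC i hA] at hi
      refine ⟨fun a _ ha => hrespect a ha, ?_, ?_⟩
      · rintro a rfl ha
        refine hread a _ ha fun j => ?_
        rw [hcf, snapshot_of_ne hA]
      · rintro ⟨b, a, hb, ha, ht, rfl, hne, hlt, hlt'⟩
        have := hwrite b a hb ha ht hne hlt
        rw [hca, snapshot_of_ne hA, ← hcf] at this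
        exact s'.lt_asymm hlt' this
    · rintro ⟨i, j, k, hi, hj, hk, hd⟩
      refine h.2.2 ⟨i, j, k, hSSI i hi, hSSI j hj, hSSI k hk, ?_⟩
      simpa only [Schedule.DangerousStructure, Schedule.Concurrent, hrw, hcc, hfc, hcf] using hd
  obtain ⟨s'', h1, h2⟩ := hR s' hs'
  exact ⟨s'', h1, fun b a hc => (hdep b a).symm.trans (h2 b a hc)⟩

end Allowed

theorem Robust.mono {S : Schema} {P : Set (Template S)} {A₁ A₂ : TemplateAllocation P}
    (hle : A₁ ≤ A₂) (h : Robust P A₁) : Robust P A₂ := by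
  intro D m 𝒯 hc A hA
  choose σ hσ using hA
  refine (h D m 𝒯 hc (fun i => A₁ (σ i)) fun i => ⟨σ i, (hσ i).1, rfl⟩).mono fun i => ?_
  rw [(hσ i).2]
  exact hle (σ i)

/-! ### Split schedules of transactions -/

namespace Operation

variable {S : Schema}

/-- Two operations on the same tuple such that the second one writes what the first one reads. -/
def RW (o p : Operation S S.Obj S.objType) : Prop :=
  o.target = p.target ∧ (o.readSet ∩ p.writeSet).Nonempty

/-- Two operations on the same tuple that conflict when they come from different transactions. -/
def Conflicts (o p : Operation S S.Obj S.objType) : Prop :=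
  o.target = p.target ∧ ((o.writeSet ∩ p.writeSet).Nonempty ∨ (o.writeSet ∩ p.readSet).Nonempty ∨
    (o.readSet ∩ p.writeSet).Nonempty)

end Operation

section Acts

variable {S : Schema} {m : ℕ} {𝒯 : TransactionSet S m}

theorem Act.getElem?_op (a : Act 𝒯) : (𝒯 a.1)[a.2.val]? = some (Act.op a) := by
  simp [Act.op]

theorem Act.op_mem (a : Act 𝒯) : Act.op a ∈ 𝒯 a.1 := List.get_mem _ _

theorem exists_act_of_getElem? {i : Fin m} {k : ℕ} {o : Operation S S.Obj S.objType}
    (h : (𝒯 i)[k]? = some o) : ∃ a : Act 𝒯, a.1 = i ∧ a.2.val = k ∧ Act.op a = o := by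
  obtain ⟨hk, h⟩ := List.getElem?_eq_some_iff.1 h
  exact ⟨⟨i, ⟨k, hk⟩⟩, rfl, rfl, h⟩

theorem exists_act_of_mem {i : Fin m} {o : Operation S S.Obj S.objType} (h : o ∈ 𝒯 i) :
    ∃ a : Act 𝒯, a.1 = i ∧ Act.op a = o := by
  obtain ⟨k, hk⟩ := List.mem_iff_getElem?.1 h
  obtain ⟨a, h1, -, h2⟩ := exists_act_of_getElem? hk
  exact ⟨a, h1, h2⟩

theorem conflict_iff {b a : Act 𝒯} :
    Conflict b a ↔ b.1 ≠ a.1 ∧ (Act.op b).Conflicts (Act.op a) := by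
  simp only [Conflict, WWConflict, WRConflict, RWConflict, SameTupleDiffTxn, Operation.Conflicts]
  tauto

theorem rwConflict_iff {b a : Act 𝒯} :
    RWConflict b a ↔ b.1 ≠ a.1 ∧ (Act.op b).RW (Act.op a) := by
  simp only [RWConflict, SameTupleDiffTxn, Operation.RW]
  tauto

end Acts

/-- The prefix of length `r` of the first transaction is executed first, then all other
transactions are executed serially, and then the rest of the first transaction. -/
theorem exists_splitSchedule {S : Schema} {n : ℕ} (𝒯 : TransactionSet S (n + 1)) (r : ℕ) :
    ∃ s : Schedule 𝒯,
      (∀ i j, s.lt (.commit i) (.commit j) ↔ i.val ≠ 0 ∧ (j.val = 0 ∨ i.val < j.val)) ∧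
      (∀ i (a : Act 𝒯), s.lt (.commit i) (.act a) ↔
        i.val ≠ 0 ∧ (a.1.val = 0 ∧ r ≤ a.2.val ∨ i.val < a.1.val)) ∧
      (∀ b a : Act 𝒯, b.1 ≠ a.1 → s.lt (.act b) (.act a) →
        b.1.val = 0 ∧ b.2.val < r ∨ s.lt (.commit b.1) (.act a)) ∧
      (∀ (a : Act 𝒯) j, a.1.val ≠ 0 → j.val ≠ 0 → s.lt (.act a) (.commit j) →
        a.1.val ≤ j.val) ∧
      (∀ a : Act 𝒯, (Act.op a).IsWrite → s.RespectsCommitOrder a) ∧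
      ∀ a : Act 𝒯, (Act.op a).IsRead → s.ReadLastCommitted a (.act a) := by
  -- Block 0 is `op₀`, block 1 the prefix of transaction 0, block `i + 1` transaction `i ≠ 0`, and
  -- block `n + 2` the rest of transaction 0 with its commit.
  let block : Act 𝒯 → ℕ := fun a =>
    if a.1.val = 0 then (if a.2.val < r then 1 else n + 2) else a.1.val + 1
  let final : Fin (n + 1) → ℕ := fun i => if i.val = 0 then n + 2 else i.val + 1
  let key : Event 𝒯 → ℕ ×ₗ ℕ := fun e => match e with
    | .init => toLex (0, 0)
    | .act a => toLex (block a, a.2)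
    | .commit i => toLex (final i, (𝒯 i).length)
  have block_spec : ∀ a, a.1.val = 0 ∧ a.2.val < r ∧ block a = 1 ∨
      a.1.val = 0 ∧ r ≤ a.2.val ∧ block a = n + 2 ∨ a.1.val ≠ 0 ∧ block a = a.1.val + 1 := by
    intro a
    simp only [block]
    split_ifs <;> omega
  have final_spec : ∀ i, i.val = 0 ∧ final i = n + 2 ∨ i.val ≠ 0 ∧ final i = i.val + 1 := by
    intro i
    simp only [final]
    split_ifs <;> omega
  have val_ne : ∀ {i j : Fin (n + 1)}, i ≠ j → i.val ≠ j.val := fun h h' => h (Fin.ext h')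
  have hcc : ∀ i j, key (.commit i) < key (.commit j) ↔
      i.val ≠ 0 ∧ (j.val = 0 ∨ i.val < j.val) := by
    intro i j
    simp only [key, Prod.Lex.toLex_lt_toLex]
    rcases eq_or_ne i j with rfl | hij
    · omega
    · have := val_ne hij
      have := final_spec i
      have := final_spec j
      omega
  have hca : ∀ i (a : Act 𝒯), key (.commit i) < key (.act a) ↔
      i.val ≠ 0 ∧ (a.1.val = 0 ∧ r ≤ a.2.val ∨ i.val < a.1.val) := by
    rintro i a
    simp only [key, Prod.Lex.toLex_lt_toLex]
    have h1 := a.2.2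
    have h2 := final_spec i
    have h3 := block_spec a
    have h4 := a.1.2
    rcases eq_or_ne i a.1 with rfl | hij
    · omega
    · have := val_ne hij
      omega
  have hac : ∀ (a : Act 𝒯) j, a.1.val ≠ 0 → j.val ≠ 0 → key (.act a) < key (.commit j) →
      a.1.val ≤ j.val := by
    intro a j hi hj h
    simp only [key, Prod.Lex.toLex_lt_toLex] at h
    have := final_spec j
    have := block_spec a
    omega
  have haa : ∀ b a : Act 𝒯, b.1 ≠ a.1 → key (.act b) < key (.act a) →
      b.1.val = 0 ∧ b.2.val < r ∨ key (.commit b.1) < key (.act a) := by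
    intro b a hne h
    rw [hca]
    simp only [key, Prod.Lex.toLex_lt_toLex] at h
    have := val_ne hne
    have := block_spec a
    have := block_spec b
    omega
  have hinj : Function.Injective key := by
    have hoff : ∀ (a : Act 𝒯) j, key (.act a) ≠ key (.commit j) := by
      rintro a j h
      simp only [key, toLex_inj, Prod.mk.injEq] at h
      have h1 := a.2.2
      have h2 := final_spec j
      have h3 := block_spec a
      have h4 := a.1.2
      rcases eq_or_ne j a.1 with rfl | hij
      · omega
      · have := val_ne hij
        omega
    rintro (_ | a | i) (_ | b | j) h
    · rfl
    · simp only [key, toLex_inj, Prod.mk.injEq] at h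
      have := block_spec b
      omega
    · simp only [key, toLex_inj, Prod.mk.injEq] at h
      have := final_spec j
      omega
    · simp only [key, toLex_inj, Prod.mk.injEq] at h
      have := block_spec a
      omega
    · simp only [key, toLex_inj, Prod.mk.injEq] at h
      have h1 := block_spec a
      have h2 := block_spec b
      have h3 := a.1.2
      have h4 := b.1.2
      obtain ⟨i, k⟩ := a
      obtain ⟨j, l⟩ := b
      obtain rfl : i = j := Fin.ext (by simp only at *; omega)
      rw [show k = l from Fin.ext h.2]
    · exact absurd h (hoff _ _)
    · simp only [key, toLex_inj, Prod.mk.injEq] at h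
      have := final_spec i
      omega
    · exact absurd h.symm (hoff _ _)
    · simp only [key, toLex_inj, Prod.mk.injEq] at h
      have h1 := final_spec i
      have h2 := final_spec j
      rw [show i = j from Fin.ext (by omega)]
  have htxn : ∀ i e f, TxnLT i e f → key e < key f := by
    rintro i e f (⟨k, l, h, rfl, rfl⟩ | ⟨k, rfl, rfl⟩)
    · simp only [key, Prod.Lex.toLex_lt_toLex, Fin.lt_def] at h ⊢
      have := block_spec ⟨i, k⟩
      have := block_spec ⟨i, l⟩
      simp only at *
      omega
    · have := k.2
      have := block_spec ⟨i, k⟩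
      have := final_spec i
      simp only [key, Prod.Lex.toLex_lt_toLex]
      simp only at *
      omega
  obtain ⟨s, hlt, hvlt, hvf⟩ := exists_schedule_of_key key hinj
    (by
      rintro (_ | a | i) h
      · exact absurd rfl h
      · have := block_spec a
        simp only [key, Prod.Lex.toLex_lt_toLex]
        omega
      · have := final_spec i
        simp only [key, Prod.Lex.toLex_lt_toLex]
        omega) htxn
    -- Reads see exactly the committed writes, so they are read-last-committed relative to
    -- themselves.
    (fun c a => key (.commit c.1) < key (.act a))
    (fun c a h => (htxn c.1 _ _ (.inr ⟨c.2, rfl, rfl⟩)).trans h)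
  refine ⟨s, by simpa only [hlt] using hcc, by simpa only [hlt] using hca,
    by simpa only [hlt] using haa, by simpa only [hlt] using hac, fun a ha b hb ht hne => ?_,
    fun a ha => ⟨?_, ?_⟩⟩
  · rw [hvlt, hlt]
    simp [ha, hb, ht, hne.symm]
  · rcases hvf a with ⟨h, -⟩ | ⟨c, h, hc, -⟩
    · exact .inl h
    · exact .inr ⟨c, h, (hlt _ _).2 hc⟩
  · rintro ⟨c, hc, ht, hlt', hv⟩
    rw [hlt] at hlt'
    rcases hvf a with ⟨-, h⟩ | ⟨d, h, -, hmax⟩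
    · exact h c hc ht hlt'
    · rw [h] at hv
      rcases hmax c hc ht hlt' with rfl | h'
      · exact s.vlt_irrefl _ hv
      · exact s.vlt_irrefl _ (s.vlt_trans _ _ _ hv h')

/-- A split schedule along a cycle of conflicts shows that a set of transactions is not robust. -/
theorem not_transactionRobust_of_split {S : Schema} {n : ℕ} (hn : 0 < n) (U : ℕ → Transaction S)
    (A : ℕ → IsoLevel) (r : ℕ)
    (hfst : ∃ k o p, k < r ∧ (U 0)[k]? = some o ∧ p ∈ U 1 ∧ o.RW p)
    (hstep : ∀ i, 0 < i → i < n → ∃ o ∈ U i, ∃ p ∈ U (i + 1), o.Conflicts p)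
    (hlast : ∃ o ∈ U n, ∃ k p, (U 0)[k]? = some p ∧ (o.RW p ∨ r ≤ k ∧ o.Conflicts p))
    (hblock : ∀ k o, k < r → (U 0)[k]? = some o → o.IsWrite → ∀ j, 0 < j → j ≤ n →
      ∀ p ∈ U j, p.IsWrite → p.target ≠ o.target)
    (hA : A 0 = .RC ∨ (U 0).length ≤ r ∧ (A 0 = .SSI → ∀ k i, 0 < k → k ≤ i → i ≤ n →
      A k = .SSI → A i = .SSI → ∀ o ∈ U 0, ∀ p ∈ U k, o.RW p → ∀ q ∈ U i, ∀ o' ∈ U 0,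
        ¬ q.RW o')) :
    ¬ TransactionRobust (m := n + 1) (fun i => U i) (fun i => A i) := by
  let 𝒯 : TransactionSet S (n + 1) := fun i => U i
  obtain ⟨s, hcc, hca, haa, hac, hresp, hread⟩ := exists_splitSchedule 𝒯 r
  -- Only a write in the prefix can precede a foreign operation without being committed, and
  -- `hblock` excludes a second writer of its tuple.
  have hwrite : ∀ b a : Act 𝒯, (Act.op b).IsWrite → (Act.op a).IsWrite →
      (Act.op b).target = (Act.op a).target → b.1 ≠ a.1 → s.lt (.act b) (.act a) →
      s.lt (.commit b.1) (.act a) := by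
    rintro ⟨i, k⟩ ⟨j, l⟩ hb ha ht hne hlt
    refine (haa _ _ hne hlt).resolve_left ?_
    rintro ⟨hi, hk⟩
    obtain rfl : i = 0 := Fin.ext hi
    exact hblock k _ hk (Act.getElem?_op (𝒯 := 𝒯) ⟨0, k⟩) hb j
      (Nat.pos_of_ne_zero fun h => hne (Fin.ext h.symm))
      (Nat.lt_succ_iff.1 j.2) _ (Act.op_mem (𝒯 := 𝒯) ⟨j, l⟩) ha ht.symm
  have hRC : ∀ i, s.AllowedRC i := by
    refine fun i => ⟨fun a _ ha => hresp a ha, fun a _ ha => hread a ha, ?_⟩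
    rintro ⟨b, a, hb, ha, ht, rfl, hne, hlt, hlt'⟩
    exact s.lt_asymm hlt' (hwrite b a hb ha ht hne hlt)
  -- No commit falls inside a transaction that is executed in one block, so its first operation sees
  -- the same commits as all the others and SI follows from RC.
  have hSI : ∀ i : Fin (n + 1), (i.val = 0 → (𝒯 i).length ≤ r) → s.AllowedSI i := by
    intro i hi
    have hfirst : ∀ a : Act 𝒯, a.1 = i → ∀ j, s.lt (.commit j) (first 𝒯 i) ↔
        s.lt (.commit j) (.act a) := by
      rintro ⟨i, k⟩ rfl j
      rw [first_eq_act, hca, hca]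
      have hk := k.2
      simp only at *
      omega
    refine ⟨fun a _ ha => hresp a ha, ?_, ?_⟩
    · rintro a rfl ha
      simp only [Schedule.ReadLastCommitted, hfirst a rfl]
      exact hread a ha
    · rintro ⟨b, a, hb, ha, ht, rfl, hne, hlt, hlt'⟩
      exact s.lt_asymm hlt' ((hfirst a rfl _).2 (hwrite b a hb ha ht hne hlt))
  -- Serial transactions are not concurrent, so only transaction 0 can be the middle of a dangerous
  -- structure.
  have hconc : ∀ i j, i.val ≠ 0 → j.val ≠ 0 → s.TxnRWDep i j → ¬ s.Concurrent i j := by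
    rintro _ _ hi hj ⟨b, a, rfl, rfl, hd⟩ ⟨h1, h2⟩
    rw [first_eq_act] at h1 h2
    exact hd.1.1.1 (Fin.ext (le_antisymm (hac ⟨b.1, ⟨0, b.2.pos⟩⟩ _ hi hj h1)
      (hac ⟨a.1, ⟨0, a.2.pos⟩⟩ _ hj hi h2)))
  have hs : s.AllowedUnder (fun i => A i) := by
    refine ⟨fun i _ => hRC i, fun i hi => hSI i fun hi0 => ?_, ?_⟩
    · obtain rfl : i = 0 := Fin.ext hi0
      rcases hA with h | h
      · simp [h] at hi
      · exact h.1
    · rintro ⟨i, j, k, hi, hj, hk, hij, hjk, hcij, hcjk, hki, hkj, -⟩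
      rw [hcc] at hkj
      have hj0 : j.val = 0 := by
        by_contra hj0
        exact hconc j k hj0 hkj.1 hjk hcjk
      obtain rfl : j = 0 := Fin.ext hj0
      obtain ⟨b, a, rfl, ha0, hd⟩ := hij
      obtain ⟨c, d, hc0, rfl, hd'⟩ := hjk
      have hb0 : b.1.val ≠ 0 := fun h => hd.1.1.1 (Fin.ext (h.trans (by rw [ha0]; rfl)))
      rcases hA with h | ⟨-, h⟩
      · simp [h] at hj
      · refine h hj d.1 b.1 (Nat.pos_of_ne_zero hkj.1) ?_ (Nat.lt_succ_iff.1 b.1.2) hk hi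
          (Act.op c) ?_ _ (Act.op_mem d) (rwConflict_iff.1 hd'.1).2 _ (Act.op_mem b) (Act.op a) ?_
          (rwConflict_iff.1 hd.1).2
        · rcases hki with h | h
          · rw [h]
          · exact (((hcc _ _).1 h).2.resolve_left hb0).le
        · have := Act.op_mem c
          rwa [hc0] at this
        · have := Act.op_mem a
          rwa [ha0] at this
  -- Viewed with all levels RC, the snapshot of an operation is the operation itself; the direction
  -- of each dependency can then be read off from commits.
  have hs' : s.AllowedUnder (fun _ => .RC) :=
    ⟨fun i _ => hRC i, fun i hi => by simp at hi, by simp⟩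
  have hdep : ∀ b a : Act 𝒯, Conflict b a → s.lt (.commit b.1) (.act a) → s.Dep b a := by
    intro b a hc hlt
    refine (s.dep_or_dep hc).resolve_right fun h => ?_
    have := hs'.not_commit_lt_snapshot_of_dep h
    rw [snapshot_of_eq rfl] at this
    exact this hlt
  have hdep' : ∀ b a : Act 𝒯, RWConflict b a → ¬ s.lt (.commit a.1) (.act b) → s.Dep b a := by
    intro b a hc hlt
    refine .inr (.inr ((s.rwDep_or_wrDep hc).resolve_right fun h => ?_))
    have := hs'.commit_lt_snapshot_of_wrDep h
    rw [snapshot_of_eq rfl] at this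
    exact hlt this
  have hpath : ∀ i (h0i : 0 < i) (hi : i ≤ n),
      Relation.TransGen s.TxnDep 0 ⟨i, Nat.lt_succ_iff.2 hi⟩ := by
    intro i h0i
    induction i, h0i using Nat.le_induction with
    | base =>
      intro hi
      obtain ⟨k, o, p, hk, ho, hp, hop⟩ := hfst
      obtain ⟨b, hb, hbk, rfl⟩ := exists_act_of_getElem? (𝒯 := 𝒯) (i := 0) ho
      obtain ⟨a, ha, rfl⟩ := exists_act_of_mem (𝒯 := 𝒯) (i := ⟨1, by omega⟩) hp
      have hbv : b.1.val = 0 := congrArg Fin.val hb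
      have hav : a.1.val = 1 := congrArg Fin.val ha
      have hne : b.1 ≠ a.1 := fun h => by
        have := congrArg Fin.val h
        omega
      refine .single ⟨b, a, hb, ha, hdep' b a (rwConflict_iff.2 ⟨hne, hop⟩) ?_⟩
      rw [hca]
      omega
    | succ i h0i ih =>
      intro hi
      refine (ih (by omega)).tail ?_
      obtain ⟨o, ho, p, hp, hop⟩ := hstep i h0i (by omega)
      obtain ⟨b, hb, rfl⟩ := exists_act_of_mem (𝒯 := 𝒯) (i := ⟨i, by omega⟩) ho
      obtain ⟨a, ha, rfl⟩ := exists_act_of_mem (𝒯 := 𝒯) (i := ⟨i + 1, by omega⟩) hp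
      have hbv : b.1.val = i := congrArg Fin.val hb
      have hav : a.1.val = i + 1 := congrArg Fin.val ha
      have hne : b.1 ≠ a.1 := fun h => by
        have := congrArg Fin.val h
        omega
      refine ⟨b, a, hb, ha, hdep b a (conflict_iff.2 ⟨hne, hop⟩) ?_⟩
      rw [hca]
      omega
  have hclose : s.TxnDep ⟨n, Nat.lt_succ_self n⟩ 0 := by
    obtain ⟨o, ho, k, p, hp, hop⟩ := hlast
    obtain ⟨b, hb, rfl⟩ := exists_act_of_mem (𝒯 := 𝒯) (i := ⟨n, by omega⟩) ho
    obtain ⟨a, ha, hak, rfl⟩ := exists_act_of_getElem? (𝒯 := 𝒯) (i := 0) hp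
    have hbv : b.1.val = n := congrArg Fin.val hb
    have hav : a.1.val = 0 := congrArg Fin.val ha
    have hne : b.1 ≠ a.1 := fun h => by
      have := congrArg Fin.val h
      omega
    refine ⟨b, a, hb, ha, ?_⟩
    rcases hop with hop | ⟨hr, hop⟩
    · refine hdep' b a (rwConflict_iff.2 ⟨hne, hop⟩) ?_
      rw [hca]
      omega
    · refine hdep b a (conflict_iff.2 ⟨hne, hop⟩) ?_
      rw [hca]
      omega
  exact fun hR => (hR s hs).not_transGen_self 0 ((hpath n hn le_rfl).tail hclose)

/-! ### Renaming tuples -/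

section Rename

variable {S : Schema} (g : S.Obj → S.Obj) (hg : ∀ t, S.objType (g t) = S.objType t)

/-- Replace the tuple of an operation along a type-preserving map. -/
def Operation.rename (o : Operation S S.Obj S.objType) : Operation S S.Obj S.objType where
  kind := o.kind
  target := g o.target
  readSet := o.readSet
  writeSet := o.writeSet
  readSet_subset := by rw [hg]; exact o.readSet_subset
  writeSet_subset := by rw [hg]; exact o.writeSet_subset
  writeSet_of_read := o.writeSet_of_read
  readSet_of_write := o.readSet_of_write

variable {g} in
theorem Operation.rename_eq_self {o : Operation S S.Obj S.objType} (h : g o.target = o.target) :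
    o.rename g hg = o := by
  obtain ⟨⟩ := o
  simp only [rename, mk.injEq, true_and, and_true]
  exact h

theorem Operation.Conflicts.rename {o p : Operation S S.Obj S.objType} (h : o.Conflicts p) :
    (o.rename g hg).Conflicts (p.rename g hg) := ⟨congrArg g h.1, h.2⟩

open Classical in
/-- Add the images of all tuples under a type-preserving map to a database. -/
noncomputable def Database.extend (D : Database S) : Database S where
  tuples R := D.tuples R ∪ (D.tuples R).image g
  type_eq := by
    intro R t ht
    rcases Finset.mem_union.1 ht with h | h
    · exact D.type_eq R t h
    · obtain ⟨u, hu, rfl⟩ := Finset.mem_image.1 h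
      rw [hg]
      exact D.type_eq R u hu

theorem InstantiatedFrom.extend {T : Transaction S} {τ : Template S} {D : Database S}
    (h : InstantiatedFrom T τ D) : InstantiatedFrom T τ (D.extend g hg) := by
  classical
  obtain ⟨μ, hμ, rfl⟩ := h
  refine ⟨μ, fun x => ?_, rfl⟩
  obtain ⟨R, hR⟩ := hμ x
  exact ⟨R, Finset.mem_union_left _ hR⟩

theorem InstantiatedFrom.rename {T : Transaction S} {τ : Template S} {D : Database S}
    (h : InstantiatedFrom T τ D) :
    InstantiatedFrom (T.map (Operation.rename g hg)) τ (D.extend g hg) := by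
  classical
  obtain ⟨μ, hμ, rfl⟩ := h
  refine ⟨⟨g ∘ μ.toFun, fun x => (hg _).trans (μ.type_eq x)⟩, fun x => ?_, ?_⟩
  · obtain ⟨R, hR⟩ := hμ x
    exact ⟨R, Finset.mem_union_right _ (Finset.mem_image_of_mem g hR)⟩
  · simp only [VarAssignment.apply, List.map_map]
    rfl

end Rename

/-- The map need not be injective: all tuples of one type outside `K` may share a fresh image, since
conflicts survive every type-preserving map. -/
theorem exists_rename {S : Schema} {F : Set S.Obj} (hF : F.Finite) (K : Set S.Obj) :
    ∃ g : S.Obj → S.Obj, (∀ t, S.objType (g t) = S.objType t) ∧ (∀ t ∈ K, g t = t) ∧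
      ∀ t ∉ K, g t ∉ F := by
  classical
  have : ∀ R, ∃ t, S.objType t = R ∧ t ∉ F := fun R => by
    obtain ⟨t, h1, h2⟩ := ((S.obj_infinite R).sdiff hF).nonempty
    exact ⟨t, h1, h2⟩
  choose f hf hf' using this
  refine ⟨fun t => if t ∈ K then t else f (S.objType t), fun t => ?_, fun t ht => if_pos ht,
    fun t ht => ?_⟩
  · by_cases h : t ∈ K
    · simp [h]
    · simp [h, hf]
  · simp [ht, hf']

theorem InstantiatedFrom.writeSet_nonempty {S : Schema} {P : Set (Template S)}
    (hP : ∀ τ ∈ P, ∀ o ∈ τ, o.IsWrite → o.writeSet.Nonempty) {T : Transaction S} {τ : P}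
    {D : Database S} (h : InstantiatedFrom T τ D) {o : Operation S S.Obj S.objType} (ho : o ∈ T)
    (hw : o.IsWrite) : o.writeSet.Nonempty := by
  obtain ⟨μ, -, rfl⟩ := h
  simp only [VarAssignment.apply, List.mem_map] at ho
  obtain ⟨o, ho, rfl⟩ := ho
  exact hP τ τ.2 o ho hw

/-! ### Split schedules of instances of templates -/

section Templates

variable {S : Schema} {P : Set (Template S)} {AP : TemplateAllocation P} {D : Database S}

/-- In a split schedule of instances of templates, the split transaction only has to avoid the
writes of the other transactions on the tuples that it needs to share with them: all its other
tuples can be replaced by fresh ones. -/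
theorem not_robust_of_split {n : ℕ} (hn : 0 < n) (U : ℕ → Transaction S) (σ : ℕ → P)
    (hU : ∀ i, InstantiatedFrom (U i) (σ i) D) (K : Set S.Obj) (r : ℕ)
    (hfst : ∃ k o p, k < r ∧ (U 0)[k]? = some o ∧ p ∈ U 1 ∧ o.RW p ∧ o.target ∈ K)
    (hstep : ∀ i, 0 < i → i < n → ∃ o ∈ U i, ∃ p ∈ U (i + 1), o.Conflicts p)
    (hlast : ∃ o ∈ U n, ∃ k p, (U 0)[k]? = some p ∧ (o.RW p ∨ r ≤ k ∧ o.Conflicts p) ∧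
      p.target ∈ K)
    (hblock : ∀ k o, k < r → (U 0)[k]? = some o → o.IsWrite → o.target ∈ K → ∀ j, 0 < j → j ≤ n →
      ∀ p ∈ U j, p.IsWrite → p.target ≠ o.target)
    (hA : AP (σ 0) = .RC ∨ (U 0).length ≤ r ∧ (AP (σ 0) = .SSI → ∀ k i, 0 < k → k ≤ i → i ≤ n →
      AP (σ k) = .SSI → AP (σ i) = .SSI → ∀ o ∈ U 0, ∀ p ∈ U k, o.RW p → ∀ q ∈ U i, ∀ o' ∈ U 0,
        ¬ q.RW o')) :
    ¬ Robust P AP := by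
  intro hR
  have hF : (⋃ i ∈ Set.Iic n, Operation.target '' {o | o ∈ U i}).Finite :=
    (Set.finite_Iic n).biUnion fun i _ => (U i).finite_toSet.image _
  obtain ⟨g, hg, hgK, hgF⟩ := exists_rename hF K
  have memF : ∀ i ≤ n, ∀ o ∈ U i, o.target ∈ ⋃ i ∈ Set.Iic n, Operation.target '' {o | o ∈ U i} :=
    fun i hi o ho => Set.mem_biUnion (Set.mem_Iic.2 hi) ⟨o, ho, rfl⟩
  let V : ℕ → Transaction S := fun i => if i = 0 then (U 0).map (Operation.rename g hg) else U i
  have hV0 : V 0 = (U 0).map (Operation.rename g hg) := if_pos rfl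
  have hV : ∀ i, i ≠ 0 → V i = U i := fun i hi => if_neg hi
  have hinst : ∀ i, InstantiatedFrom (V i) (σ i) (D.extend g hg) := by
    intro i
    rcases eq_or_ne i 0 with rfl | hi
    · rw [hV0]
      exact (hU 0).rename g hg
    · rw [hV i hi]
      exact (hU i).extend g hg
  have hget : ∀ {k : ℕ} {o : Operation S S.Obj S.objType}, (U 0)[k]? = some o → (V 0)[k]? = some (o.rename g hg) := by
    intro k o h
    rw [hV0, List.getElem?_map, h]
    rfl
  -- A renamed operation that still meets a tuple of another transaction was not moved, so nothing
  -- new has to be avoided.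
  have hmem : ∀ i, 0 < i → i ≤ n → ∀ p ∈ U i, ∀ o : Operation S S.Obj S.objType,
      (o.rename g hg).target = p.target → o.target ∈ K ∧ o.rename g hg = o := by
    intro i _ hi p hp o h
    have hK : o.target ∈ K := by
      by_contra hK
      have := hgF _ hK
      rw [show g o.target = p.target from h] at this
      exact this (memF i hi p hp)
    exact ⟨hK, Operation.rename_eq_self hg (hgK _ hK)⟩
  refine not_transactionRobust_of_split hn V (fun i => AP (σ i)) r ?_ ?_ ?_ ?_ ?_
    (hR (D.extend g hg) (n + 1) (fun i => V i) (fun i => ⟨σ i, (σ i).2, hinst i⟩) _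
      fun i => ⟨σ i, hinst i, rfl⟩)
  · obtain ⟨k, o, p, hk, ho, hp, hop, hK⟩ := hfst
    refine ⟨k, o, p, hk, ?_, by rwa [hV 1 one_ne_zero], hop⟩
    rw [hget ho, Operation.rename_eq_self hg (hgK _ hK)]
  · intro i hi hin
    rw [hV i hi.ne', hV (i + 1) (Nat.succ_ne_zero i)]
    exact hstep i hi hin
  · obtain ⟨o, ho, k, p, hp, hop, hK⟩ := hlast
    refine ⟨o, by rwa [hV n hn.ne'], k, p, ?_, hop⟩
    rw [hget hp, Operation.rename_eq_self hg (hgK _ hK)]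
  · intro k o hk ho hw j hj hjn p hp hpw ht
    rw [hV0, List.getElem?_map, Option.map_eq_some_iff] at ho
    obtain ⟨o, ho, rfl⟩ := ho
    rw [hV j hj.ne'] at hp
    obtain ⟨hK, he⟩ := hmem j hj hjn p hp o ht.symm
    rw [he] at ht
    exact hblock k o hk ho hw hK j hj hjn p hp hpw ht
  · refine hA.imp id fun h => ⟨by rw [hV0, List.length_map]; exact h.1, fun hS k i hk hki hin
      hSk hSi o ho p hp hop q hq o' ho' hqo => ?_⟩
    rw [hV0] at ho ho'
    rw [hV k hk.ne'] at hp
    rw [hV i (hk.trans_le hki).ne'] at hq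
    obtain ⟨u, hu, rfl⟩ := List.mem_map.1 ho
    obtain ⟨u', hu', rfl⟩ := List.mem_map.1 ho'
    obtain ⟨-, he⟩ := hmem k hk (hki.trans hin) p hp u hop.1
    obtain ⟨-, he'⟩ := hmem i (hk.trans_le hki) hin q hq u' hqo.1.symm
    rw [he] at hop
    rw [he'] at hqo
    exact h.2 hS k i hk hki hin hSk hSi u hu p hp hop q hq u' hu' hqo

/-- A read operation under read committed that another template can overwrite must not be followed
by the first write on its tuple: otherwise a second copy of the transaction fits in between. -/
theorem not_robust_of_read_write {ρ ρ' : P} {T T' : Transaction S} (hT : InstantiatedFrom T ρ D)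
    (hT' : InstantiatedFrom T' ρ' D) (hA : AP ρ = .RC) {k l : ℕ}
    {o p q : Operation S S.Obj S.objType} (ho : T[k]? = some o) (hq : T[l]? = some q) (hkl : k < l)
    (hp : p ∈ T') (hop : o.RW p) (hqo : q.target = o.target) (hqw : q.writeSet.Nonempty)
    (hno : ∀ j o', j ≤ k → T[j]? = some o' → o'.IsWrite → o'.target ≠ o.target) :
    ¬ Robust P AP := by
  -- The cycle is `T → T' → T → T` with two copies of `T`, split right after `o`. The copies
  -- conflict through `q`, which needs its nonempty write set.
  refine not_robust_of_split (D := D) (n := 2) two_pos (fun i => if i = 1 then T' else T)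
    (fun i => if i = 1 then ρ' else ρ) (fun i => ?_) {o.target} (k + 1)
    ⟨k, o, p, Nat.lt_succ_self k, ho, hp, hop, rfl⟩ ?_ ?_ ?_ (.inl hA)
  · by_cases hi : i = 1
    · simpa [hi] using hT'
    · simpa [hi] using hT
  · intro i h1 h2
    obtain rfl : i = 1 := by omega
    refine ⟨p, hp, o, List.mem_of_getElem? ho, hop.1.symm, .inr (.inl ?_)⟩
    rw [Set.inter_comm]
    exact hop.2
  · exact ⟨q, List.mem_of_getElem? hq, l, q, hq, .inr ⟨hkl, rfl, .inl (by simpa using hqw)⟩, hqo⟩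
  · intro j o' hj ho' hw ht
    exact absurd ht (hno j o' (Nat.lt_succ_iff.1 hj) ho' hw)

end Templates

/-! ### Antidependencies against the commit order -/

section Cycles

variable {S : Schema} {P : Set (Template S)} {AP : TemplateAllocation P} {D : Database S} {m : ℕ}
  {𝒯 : TransactionSet S m} {s : Schedule 𝒯} {A : Fin m → IsoLevel} {σ : Fin m → P}

namespace Schedule

theorem commit_lt_commit {i j : Fin m} (hne : i ≠ j) (h : ¬ s.lt (.commit j) (.commit i)) :
    s.lt (.commit i) (.commit j) :=
  (s.lt_total _ _ (by simpa using hne)).resolve_right h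

theorem Dep.wrDep_of_not_isWrite {b a : Act 𝒯} (h : s.Dep b a) (ha : ¬ (Act.op a).IsWrite) :
    s.WRDep b a := by
  rcases h with h | h | h
  · exact absurd h.1.isWrite_right ha
  · exact h
  · exact absurd h.1.isWrite ha

theorem AllowedUnder.rwDep_of_commit_lt (h : s.AllowedUnder A) {b a : Act 𝒯} (hd : s.Dep b a)
    (hlt : s.lt (.commit a.1) (.commit b.1)) : s.RWDep b a := by
  rcases hd with hd | hd | hd
  · exact absurd (h.commit_lt_of_wwDep hd) (s.lt_asymm hlt)
  · exact absurd (s.lt_trans _ _ _ (h.commit_lt_snapshot_of_wrDep hd) (s.snapshot_lt_commit A a))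
      (s.lt_asymm hlt)
  · exact hd

end Schedule

/-- In a robust set of templates, a transaction with an antidependency to a transaction that
commits earlier does not write the tuple in question. -/
theorem Robust.not_isWrite_of_rwDep (hR : Robust P AP)
    (hP : ∀ τ ∈ P, ∀ o ∈ τ, o.IsWrite → o.writeSet.Nonempty)
    (hσ : ∀ i, InstantiatedFrom (𝒯 i) (σ i) D) (h : s.AllowedUnder A) {b a c : Act 𝒯}
    (hA : A b.1 = .RC → AP (σ b.1) = .RC) (hd : s.RWDep b a)
    (hlt : s.lt (.commit a.1) (.commit b.1)) (hcb : c.1 = b.1)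
    (ht : (Act.op c).target = (Act.op b).target) : ¬ (Act.op c).IsWrite := by
  -- Such a write uses a snapshot after the commit of `a`, hence after the snapshot of `b`. Only RC
  -- allows this, and only for a write that follows `b`.
  have later : ∀ c : Act 𝒯, c.1 = b.1 → (Act.op c).target = (Act.op b).target →
      (Act.op c).IsWrite → A b.1 = .RC ∧ b.2.val < c.2.val := by
    intro c hcb ht hw
    rcases h.commit_lt_snapshot_of_isWrite hw hd.1.isWrite (ht.trans hd.1.1.2)
      (hcb.trans_ne hd.1.1.1) with h' | h'
    · rw [hcb] at h'
      exact absurd (s.lt_trans _ _ _ h' (s.snapshot_lt_commit A a)) (s.lt_asymm hlt)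
    · exact Schedule.eq_RC_of_snapshot_lt hcb.symm
        (s.lt_trans _ _ _ (h.snapshot_lt_commit_of_rwDep hd) h')
  intro hw
  obtain ⟨hRC, hbc⟩ := later c hcb ht hw
  have hc := Act.getElem?_op c
  simp only [hcb] at hc
  refine not_robust_of_read_write (hσ b.1) (hσ a.1) (hA hRC) (Act.getElem?_op b) hc hbc
    (Act.op_mem a) (rwConflict_iff.1 hd.1).2 ht
    ((hσ c.1).writeSet_nonempty hP (Act.op_mem c) hw) (fun j o' hj ho' hw' ht' => ?_) hR
  obtain ⟨c', hc1, hc2, rfl⟩ := exists_act_of_getElem? ho'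
  have := (later c' hc1 ht' hw').2
  omega

/-- A cycle of conflicts along which a transaction under read committed first reads a tuple that
the next transaction overwrites, and then reads the same tuple from the previous transaction. -/
theorem Robust.isWrite_of_reads_around (hR : Robust P AP)
    (hσ : ∀ i, InstantiatedFrom (𝒯 i) (σ i) D) {c : ℕ → Fin m}
    (hstep : ∀ i, ∃ b a : Act 𝒯, b.1 = c i ∧ a.1 = c (i + 1) ∧ Conflict b a) {n : ℕ} (hn : 0 < n)
    {k : ℕ} {b a b' a' : Act 𝒯} (hb : b.1 = c k) (ha : a.1 = c (k + 1)) (hc : RWConflict b a)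
    (hb' : b'.1 = c (k + n)) (ha' : a'.1 = c k) (hc' : Conflict b' a')
    (hA : AP (σ (c k)) = .RC) (ht : (Act.op a').target = (Act.op b).target)
    (hlt : b.2.val < a'.2.val) :
    ∃ w : Act 𝒯, w.1 = c k ∧ (Act.op w).target = (Act.op b).target ∧ (Act.op w).IsWrite := by
  -- Without writes of this tuple, nothing in the prefix blocks a split right after `b`.
  by_contra! hno
  refine not_robust_of_split (D := D) hn (fun i => 𝒯 (c (k + i))) (fun i => σ (c (k + i)))
    (fun i => hσ _) {(Act.op b).target} (b.2.val + 1)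
    ⟨b.2, Act.op b, Act.op a, Nat.lt_succ_self _, ?_, ?_, (rwConflict_iff.1 hc).2, rfl⟩ ?_
    ⟨Act.op b', ?_, a'.2, Act.op a', ?_, .inr ⟨hlt, (conflict_iff.1 hc').2⟩, ht⟩ ?_
    (.inl hA) hR
  · simpa only [add_zero, ← hb] using Act.getElem?_op b
  · simpa only [← ha] using Act.op_mem a
  · intro i _ _
    obtain ⟨b, a, hb, ha, hc⟩ := hstep (k + i)
    exact ⟨Act.op b, by simpa only [← hb] using Act.op_mem b, Act.op a,
      by simpa only [← add_assoc, ← ha] using Act.op_mem a, (conflict_iff.1 hc).2⟩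
  · simpa only [← hb'] using Act.op_mem b'
  · simpa only [add_zero, ← ha'] using Act.getElem?_op a'
  · intro j o _ ho hw hK
    obtain ⟨w, hw1, -, rfl⟩ := exists_act_of_getElem? ho
    exact absurd hw (hno w hw1 hK)

end Cycles

/-! ### Mixing two robust allocations -/

/-- Robustness is preserved when every template is given one of the levels that two robust
allocations assign to it. -/
theorem Robust.of_forall_eq_or_eq {S : Schema} {P : Set (Template S)}
    (hP : ∀ τ ∈ P, ∀ o ∈ τ, o.IsWrite → o.writeSet.Nonempty) {A₁ A₂ B : TemplateAllocation P}
    (h₁ : Robust P A₁) (h₂ : Robust P A₂) (hB : ∀ τ, B τ = A₁ τ ∨ B τ = A₂ τ) : Robust P B := by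
  intro D m 𝒯 _ A hA s h
  choose σ hσ using hA
  obtain ⟨hσ, hAB⟩ := forall_and.1 hσ
  have hBR : ∀ i, ∃ AP, Robust P AP ∧ AP (σ i) = A i := by
    intro i
    rw [hAB]
    rcases hB (σ i) with h | h
    · exact ⟨A₁, h₁, h.symm⟩
    · exact ⟨A₂, h₂, h.symm⟩
  by_contra hns
  obtain ⟨N, c, hN, hper, hrel, hchord⟩ :=
    exists_minimal_cycle fun hwf => hns (s.conflictSerializable_of_wellFounded hwf)
  -- start the cycle right before a transaction that commits first
  obtain ⟨i₀, hi₀⟩ : ∃ i₀, ∀ i, ¬ s.lt (.commit (c i)) (.commit (c i₀)) := by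
    have : IsTrans (Fin m) fun i j => s.lt (.commit i) (.commit j) :=
      ⟨fun _ _ _ h h' => s.lt_trans _ _ _ h h'⟩
    have : Std.Irrefl fun i j : Fin m => s.lt (.commit i) (.commit j) :=
      ⟨fun _ => s.lt_irrefl _⟩
    obtain ⟨_, ⟨i₀, rfl⟩, hmin⟩ := (Finite.wellFounded_of_trans_of_irrefl
      fun i j : Fin m => s.lt (.commit i) (.commit j)).has_min (Set.range c) ⟨_, 0, rfl⟩
    exact ⟨i₀, fun i => hmin _ ⟨i, rfl⟩⟩
  -- The shift is by `i₀ - 1`; one period is added because `i₀` may be 0.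
  wlog hi₁ : i₀ = 1 generalizing c i₀
  · refine this (fun i => c (i + (i₀ + N - 1))) (fun i => ?_) (fun i => ?_) (fun i l hil hr => ?_) 1
      (fun i => ?_) rfl
    · rw [add_right_comm, hper]
    · rw [add_right_comm]
      exact hrel _
    · have := hchord _ _ (Nat.add_le_add_right hil _) hr
      omega
    · rw [show 1 + (i₀ + N - 1) = i₀ + N by omega, hper]
      exact hi₀ _
  subst hi₁
  have hN1 : 1 < N := by
    refine lt_of_le_of_ne hN fun h => (hrel 0).ne ?_
    rw [← hper 0, ← h]
  have hmin : ∀ i e, s.lt e (.commit (c 1)) → s.lt e (.commit (c i)) := by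
    intro i e he
    by_cases hi : c i = c 1
    · rwa [hi]
    · exact s.lt_trans _ _ _ he (Schedule.commit_lt_commit (Ne.symm hi) (hi₀ i))
  -- A second visit to `c 0` would give a chord into `c 0` from the transaction before it.
  have hdist : ∀ j, 0 < j → j < N → c 0 ≠ c j := by
    intro j h0 hj he
    have hr := hrel (j - 1)
    rw [Nat.sub_add_cancel h0, ← he] at hr
    have := hchord 0 (j - 1) (Nat.zero_le _) hr
    omega
  have h10 : s.lt (.commit (c 1)) (.commit (c 0)) :=
    Schedule.commit_lt_commit (hdist 1 one_pos hN1).symm (hi₀ 0)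
  choose b a hb ha hd using hrel
  have hc : ∀ i, Conflict (b i) (a i) := fun i => (hd i).conflict
  have hcN : c N = c 0 := by
    have := hper 0
    rwa [zero_add] at this
  have hab : ∀ i, (a i).1 = (b (i + 1)).1 := fun i => (ha i).trans (hb (i + 1)).symm
  have hlast : (a (N - 1)).1 = c 0 := by
    rw [ha, Nat.sub_add_cancel hN, hcN]
  -- antidependencies against the commit order
  have hcf : ∀ i, s.lt (.commit (c (i + 1))) (.commit (c i)) → s.RWDep (b i) (a i) ∧
      ∀ w : Act 𝒯, w.1 = c i → (Act.op w).target = (Act.op (b i)).target →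
        ¬ (Act.op w).IsWrite := by
    intro i hlt
    rw [← ha, ← hb] at hlt
    have hrw := h.rwDep_of_commit_lt (hd i) hlt
    obtain ⟨AP, hR, hAP⟩ := hBR (b i).1
    exact ⟨hrw, fun w hw ht => hR.not_isWrite_of_rwDep hP hσ h (fun h' => hAP.trans h') hrw hlt
      (hw.trans (hb i).symm) ht⟩
  -- no transaction reads the same tuple first before and then after going around the cycle
  have haround : ∀ (k : ℕ) (b' a' : Act 𝒯), b'.1 = c (k + (N - 1)) → a'.1 = c k → Conflict b' a' →
      s.lt (.commit (c (k + 1))) (.commit (c k)) → A (c k) = .RC →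
      (Act.op a').target = (Act.op (b k)).target → ¬ (b k).2.val < a'.2.val := by
    intro k b' a' hb' ha' hc' hlt hRC ht hlt'
    obtain ⟨hrw, hno⟩ := hcf k hlt
    obtain ⟨AP, hR, hAP⟩ := hBR (c k)
    obtain ⟨w, h1, h2, h3⟩ := hR.isWrite_of_reads_around hσ
      (fun i => ⟨b i, a i, hb i, ha i, hc i⟩) (Nat.sub_pos_of_lt hN1) (hb k) (ha k) hrw.1 hb' ha'
      hc' (hAP.trans hRC) ht hlt'
    exact hno w h1 h2 h3
  obtain ⟨hrw0, hno0⟩ := hcf 0 h10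
  have hsnap0 : s.lt (snapshot A (b 0)) (.commit (c 1)) := by
    have := h.snapshot_lt_commit_of_rwDep hrw0
    rwa [ha] at this
  -- The snapshot of `b 0` precedes the commit of `c 1`, hence every commit on the cycle. A snapshot
  -- of `c 0` after one of these commits is a later one, which forces RC.
  have hafter : ∀ i (w : Act 𝒯), w.1 = c 0 → s.lt (.commit (c i)) (snapshot A w) →
      A (c 0) = .RC ∧ (b 0).2.val < w.2.val := by
    intro i w hw hlt
    have := Schedule.eq_RC_of_snapshot_lt ((hb 0).trans hw.symm)
      (s.lt_trans _ _ _ (hmin i _ hsnap0) hlt)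
    simpa only [hb] using this
  -- how the cycle returns to its first transaction
  have hreturn : s.RWDep (b (N - 1)) (a (N - 1)) ∨
      A (c 0) = .RC ∧ (b 0).2.val < (a (N - 1)).2.val := by
    rcases hd (N - 1) with hdep | hdep | hdep
    · refine .inr ?_
      rcases h.commit_lt_snapshot_of_isWrite hdep.1.isWrite_left hdep.1.isWrite_right hdep.1.1.2
        hdep.1.1.1 with h' | h'
      · rw [hb] at h'
        exact hafter _ _ hlast h'
      · exact absurd (s.lt_trans _ _ _ h' (s.snapshot_lt_commit A _))
          (s.lt_asymm (h.commit_lt_of_wwDep hdep))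
    · have h' := h.commit_lt_snapshot_of_wrDep hdep
      rw [hb] at h'
      exact .inr (hafter _ _ hlast h')
    · exact .inl hdep
  -- If the cycle leaves and re-enters `c 0` on one tuple, then `c 0` does not write it. It
  -- re-enters through a read after `b 0`, which `haround` excludes.
  by_cases hxy : (Act.op (a (N - 1))).target = (Act.op (b 0)).target
  · have hw := hno0 _ hlast hxy
    have hlt := h.commit_lt_snapshot_of_wrDep ((hd (N - 1)).wrDep_of_not_isWrite hw)
    rw [hb] at hlt
    obtain ⟨hRC, hlt⟩ := hafter _ _ hlast hlt
    exact haround 0 _ _ (by rw [hb, zero_add]) hlast (hc _) h10 hRC hxy hlt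
  have hyN : (Act.op (b (N - 1))).target = (Act.op (a (N - 1))).target := (hc _).target_eq
  -- the final segment of the cycle on one tuple
  have hpex : ∃ p, p < N ∧ ∀ j, p ≤ j → j < N →
      (Act.op (b j)).target = (Act.op (a (N - 1))).target :=
    ⟨N - 1, by omega, fun j h1 h2 => by rw [show j = N - 1 by omega, hyN]⟩
  classical
  obtain ⟨p, ⟨hpN, hp⟩, hpmin⟩ : ∃ p, (p < N ∧ ∀ j, p ≤ j → j < N →
      (Act.op (b j)).target = (Act.op (a (N - 1))).target) ∧
      ∀ q < p, ¬ (q < N ∧ ∀ j, q ≤ j → j < N →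
        (Act.op (b j)).target = (Act.op (a (N - 1))).target) :=
    ⟨Nat.find hpex, Nat.find_spec hpex, fun q => Nat.find_min hpex⟩
  have hp0 : 0 < p := by
    rcases Nat.eq_zero_or_pos p with rfl | h
    · exact absurd (hp 0 le_rfl hN).symm hxy
    · exact h
  have hpy : (Act.op (b (p - 1))).target ≠ (Act.op (a (N - 1))).target := by
    intro he
    refine hpmin (p - 1) (by omega) ⟨by omega, fun j h1 h2 => ?_⟩
    rcases h1.eq_or_lt with rfl | h1
    · exact he
    · exact hp j (by omega) h2
  -- no transaction in this segment writes the tuple after the first transaction has written it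
  have hseg : ∀ j, p ≤ j → j < N → ∀ w : Act 𝒯, w.1 = c j →
      (Act.op w).target = (Act.op (a (N - 1))).target → (Act.op w).IsWrite →
      ¬ s.lt (.commit (c 0)) (.commit (c j)) := by
    intro j hpj hjN w hwj hwt hw hlt
    -- Follow the segment from `c j` to the first edge `c k → c (k + 1)` whose end commits no later
    -- than `c 0`. It runs against the commit order, so `c k` does not write the tuple and `j < k`.
    have hkex : ∃ k, j ≤ k ∧ ¬ s.lt (.commit (c 0)) (.commit (c (k + 1))) :=
      ⟨N - 1, by omega, by rw [Nat.sub_add_cancel hN, hcN]; exact s.lt_irrefl _⟩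
    obtain ⟨k, ⟨hjk, hk⟩, hkmin⟩ : ∃ k, (j ≤ k ∧
        ¬ s.lt (.commit (c 0)) (.commit (c (k + 1)))) ∧
        ∀ q < k, ¬ (j ≤ q ∧ ¬ s.lt (.commit (c 0)) (.commit (c (q + 1)))) :=
      ⟨Nat.find hkex, Nat.find_spec hkex, fun q => Nat.find_min hkex⟩
    have hkN : k < N := by
      by_contra hkN
      exact hkmin (N - 1) (by omega) ⟨by omega, by
        rw [Nat.sub_add_cancel hN, hcN]
        exact s.lt_irrefl _⟩
    have hgt : ∀ l, j ≤ l → l ≤ k → s.lt (.commit (c 0)) (.commit (c l)) := by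
      intro l hjl hlk
      rcases hjl.eq_or_lt with rfl | hjl
      · exact hlt
      · have := hkmin (l - 1) (by omega)
        rw [Nat.sub_add_cancel (by omega : 1 ≤ l)] at this
        by_contra h'
        exact this ⟨by omega, h'⟩
    have hle : ∀ e, s.lt e (.commit (c (k + 1))) → ¬ s.lt (.commit (c 0)) e :=
      fun e he h' => hk (s.lt_trans _ _ _ h' he)
    have hkk : s.lt (.commit (c (k + 1))) (.commit (c k)) := by
      by_cases he : c (k + 1) = c 0
      · rw [he]
        exact hgt k hjk le_rfl
      · exact s.lt_trans _ _ _ (Schedule.commit_lt_commit he hk)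
          (hgt k hjk le_rfl)
    obtain ⟨hrw, hno⟩ := hcf k hkk
    have hjk' : j < k := by
      refine lt_of_le_of_ne hjk ?_
      rintro rfl
      exact hno w hwj (hwt.trans (hp j hpj hjN).symm) hw
    obtain ⟨k, rfl⟩ : ∃ l, k = l + 1 := ⟨k - 1, by omega⟩
    have htk : (Act.op (a k)).target = (Act.op (b (k + 1))).target := by
      rw [hp (k + 1) (by omega) hkN, ← (hc k).target_eq, hp k (by omega) (by omega)]
    have hlt' := h.commit_lt_snapshot_of_wrDep
      ((hd k).wrDep_of_not_isWrite (hno (a k) (ha k) htk))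
    have hbk := h.snapshot_lt_commit_of_rwDep hrw
    rw [hb] at hlt'
    rw [ha] at hbk
    -- The incoming edge of this transaction is a read from a transaction that commits after `c 0`,
    -- while the outgoing read has its snapshot before a commit that is not after that of `c 0`. So
    -- it reads the tuple twice, as in `haround`.
    have hsn : s.lt (snapshot A (b (k + 1))) (snapshot A (a k)) := by
      have h0k := s.lt_trans _ _ _ (hgt k (by omega) (by omega)) hlt'
      by_contra h'
      by_cases he : snapshot A (b (k + 1)) = snapshot A (a k)
      · exact hle _ hbk (he ▸ h0k)
      · exact hle _ hbk (s.lt_trans _ _ _ h0k ((s.lt_total _ _ he).resolve_left h'))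
    obtain ⟨hRC, hlt''⟩ := Schedule.eq_RC_of_snapshot_lt (hab k).symm hsn
    rw [hb] at hRC
    refine haround (k + 1) (b k) (a k) ?_ (ha k) (hc k) hkk hRC htk hlt''
    rw [hb, add_assoc, Nat.add_sub_cancel' hN1.le, hper]
  -- rename the tuple outside this segment and split the first transaction
  set y := (Act.op (a (N - 1))).target with hy
  obtain ⟨g, hg, hgK, hgF⟩ := exists_rename
    (Set.finite_range fun w : Act 𝒯 => (Act.op w).target) {y}ᶜ
  have hgy : g y ∉ Set.range fun w : Act 𝒯 => (Act.op w).target := hgF y (by simp)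
  have hgne : ∀ {t}, t ≠ y → g t = t := fun ht => hgK _ (by simpa using ht)
  -- Conflicts between renamed neighbours survive. The edge that enters the segment at `p` is not on
  -- `y`, because `p` is minimal, and the edge out of `c 0` is not on `y` by `hxy`.
  let U : ℕ → Transaction S := fun i =>
    if 0 < i ∧ i < p then (𝒯 (c i)).map (Operation.rename g hg) else 𝒯 (c i)
  have hUr : ∀ i, 0 < i → i < p → U i = (𝒯 (c i)).map (Operation.rename g hg) :=
    fun i h1 h2 => if_pos ⟨h1, h2⟩
  have hUp : ∀ i, p ≤ i → U i = 𝒯 (c i) := fun i h1 => if_neg (by omega)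
  have hU0 : U 0 = 𝒯 (c 0) := if_neg (by omega)
  have hUinst : ∀ i, InstantiatedFrom (U i) (σ (c i)) (D.extend g hg) := by
    intro i
    by_cases hi : 0 < i ∧ i < p
    · rw [hUr i hi.1 hi.2]
      exact (hσ _).rename g hg
    · rw [show U i = 𝒯 (c i) from if_neg hi]
      exact (hσ _).extend g hg
  have hmemU : ∀ {i : ℕ} {w : Act 𝒯}, w.1 = c i → (Act.op w).target ≠ y → Act.op w ∈ U i := by
    intro i w hw ht
    have hmem : Act.op w ∈ 𝒯 (c i) := hw ▸ Act.op_mem w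
    by_cases hi : 0 < i ∧ i < p
    · rw [hUr i hi.1 hi.2]
      exact List.mem_map.2 ⟨_, hmem, Operation.rename_eq_self hg (hgne ht)⟩
    · rwa [show U i = 𝒯 (c i) from if_neg hi]
  have hofU : ∀ (i : ℕ) (v : Act 𝒯), ∀ o ∈ U i, o.target = (Act.op v).target →
      (∃ w : Act 𝒯, w.1 = c i ∧ Act.op w = o) ∧ (o.target = y → i = 0 ∨ p ≤ i) := by
    intro i v o ho ht
    by_cases hi : 0 < i ∧ i < p
    · rw [hUr i hi.1 hi.2] at ho
      obtain ⟨u, hu, rfl⟩ := List.mem_map.1 ho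
      have hne : u.target ≠ y := by
        intro he
        refine hgy ⟨v, ?_⟩
        rw [← he]
        exact ht.symm
      rw [Operation.rename_eq_self hg (hgne hne)]
      exact ⟨exists_act_of_mem hu, fun he => absurd he hne⟩
    · rw [show U i = 𝒯 (c i) from if_neg hi] at ho
      exact ⟨exists_act_of_mem ho, fun _ => by omega⟩
  -- Under RC the split is right after `b 0`; under SI and SSI the prefix is the whole of `c 0`.
  have hsplit : ∀ AP, Robust P AP → (A (c 0) = .RC → AP (σ (c 0)) = .RC) →
      (A (c 0) ≠ .RC → AP (σ (c 0)) = .SSI → ¬ (AP (σ (c 1)) = .SSI ∧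
        AP (σ (c (N - 1))) = .SSI)) → False := by
    intro AP hR hRC hSSI
    refine not_robust_of_split (D := D.extend g hg) (n := N - 1) (by omega) U (fun i => σ (c i))
      hUinst {(Act.op (b 0)).target, y}
      (if A (c 0) = .RC then (b 0).2.val + 1 else (𝒯 (c 0)).length)
      ⟨(b 0).2, Act.op (b 0), Act.op (a 0), ?_, ?_, ?_, (rwConflict_iff.1 hrw0.1).2, by simp⟩ ?_
      ⟨Act.op (b (N - 1)), ?_, (a (N - 1)).2, Act.op (a (N - 1)), ?_, ?_, by simp [hy]⟩ ?_ ?_ hR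
    · split_ifs
      · exact Nat.lt_succ_self _
      · rw [← hb]
        exact (b 0).2.2
    · rw [hU0, ← hb]
      exact Act.getElem?_op _
    · refine hmemU (ha 0) fun he => hxy ?_
      rw [← he, (hc 0).target_eq]
    · intro i hi hiN
      by_cases hip : i + 1 < p
      · refine ⟨_, ?_, _, ?_, (conflict_iff.1 (hc i)).2.rename g hg⟩
        · rw [hUr i hi (by omega)]
          exact List.mem_map_of_mem (hb i ▸ Act.op_mem (b i))
        · rw [hUr (i + 1) (by omega) hip]
          exact List.mem_map_of_mem (ha i ▸ Act.op_mem (a i))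
      · refine ⟨_, ?_, Act.op (a i), ?_, (conflict_iff.1 (hc i)).2⟩
        · by_cases hip' : i + 1 = p
          · refine hmemU (hb i) ?_
            rwa [← hip', Nat.add_sub_cancel] at hpy
          · rw [hUp i (by omega), ← hb]
            exact Act.op_mem _
        · rw [hUp (i + 1) (by omega), ← ha]
          exact Act.op_mem _
    · rw [hUp _ (by omega), ← hb]
      exact Act.op_mem _
    · rw [hU0, ← hlast]
      exact Act.getElem?_op _
    · rcases hreturn with hrw | ⟨h1, h2⟩
      · exact .inl (rwConflict_iff.1 hrw.1).2
      · rw [if_pos h1]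
        exact .inr ⟨h2, (conflict_iff.1 (hc _)).2⟩
    · intro k o hk ho hw hK j hj hjN q hq hqw ht
      rw [hU0] at ho
      obtain ⟨v, hv, hvk, rfl⟩ := exists_act_of_getElem? ho
      -- Writes of `x` by `c 0` are excluded by `hno0`. For `y`, a second writer that commits after
      -- `c 0` contradicts `hseg`, and one that commits before the snapshot puts the write of `c 0`
      -- behind `b 0`, outside the prefix.
      rcases hK with hK | hK
      · exact hno0 v hv hK hw
      · obtain ⟨⟨w, hw1, rfl⟩, hjp⟩ := hofU j v q hq ht
        have hjp := (hjp (ht.trans hK)).resolve_left (by omega)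
        refine hseg j hjp (by omega) w hw1 (ht.trans hK) hqw ?_
        have hne : v.1 ≠ w.1 := by
          rw [hv, hw1]
          exact hdist j hj (by omega)
        rcases h.commit_lt_snapshot_of_isWrite hw hqw ht.symm hne with h' | h'
        · rw [← hv, ← hw1]
          exact s.lt_trans _ _ _ h' (s.snapshot_lt_commit A w)
        · rw [hw1] at h'
          obtain ⟨h1, h2⟩ := hafter j v hv h'
          rw [if_pos h1] at hk
          omega
    · by_cases hA0 : A (c 0) = .RC
      · exact .inl (hRC hA0)
      refine .inr ⟨by rw [hU0, if_neg hA0], fun hS k i hk hki hiN hSk hSi o ho q hq hoq q' hq' o'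
        ho' hqo => ?_⟩
      rw [hU0] at ho ho'
      obtain ⟨v, hv, rfl⟩ := exists_act_of_mem ho
      obtain ⟨v', hv', rfl⟩ := exists_act_of_mem ho'
      obtain ⟨⟨w, hwk, rfl⟩, -⟩ := hofU k v q hq hoq.1.symm
      obtain ⟨⟨w', hwi, rfl⟩, -⟩ := hofU i v' q' hq' hqo.1
      -- Under SI or SSI the conflict is an antidependency out of `c 0`, since `c 0` reads nothing
      -- from the cycle; as the cycle has no chords, it leads to `c 1`.
      have hk1 : k = 1 := by
        have hne : v.1 ≠ w.1 := by
          rw [hv, hwk]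
          exact hdist k hk (by omega)
        rcases s.rwDep_or_wrDep (rwConflict_iff.2 ⟨hne, hoq⟩) with h' | h'
        · have := hchord k N (by omega) ⟨v, w, hv.trans hcN.symm, hwk, .inr (.inr h')⟩
          omega
        · have := h.commit_lt_snapshot_of_wrDep h'
          rw [hwk] at this
          exact absurd (hafter k v hv this).1 hA0
      -- An edge from `c i` into `c 0` is a chord unless `i = N - 1`. The opposite edge could only
      -- lead to `c 1`, as a wr-dependency, but `c 1` commits before `c 0`.
      have hi1 : i = N - 1 := by
        have hne : w'.1 ≠ v'.1 := by
          rw [hv', hwi]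
          exact (hdist i (by omega) (by omega)).symm
        rcases s.rwDep_or_wrDep (rwConflict_iff.2 ⟨hne, hqo⟩) with h' | h'
        · have := hchord 0 i (Nat.zero_le _) ⟨w', v', hwi, hv', .inr (.inr h')⟩
          omega
        · have h1 := hchord i N (by omega) ⟨v', w', hv'.trans hcN.symm, hwi, .inr (.inl h')⟩
          obtain rfl : i = 1 := by omega
          have h2 := s.lt_trans _ _ _ (h.commit_lt_snapshot_of_wrDep h')
            (s.snapshot_lt_commit A w')
          rw [hv', hwi] at h2
          exact absurd h2 (s.lt_asymm h10)
      subst hk1 hi1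
      exact hSSI hA0 hS ⟨hSk, hSi⟩
  by_cases hA0 : A (c 0) = .RC
  · obtain ⟨AP, hR, hAP⟩ := hBR (c 0)
    exact hsplit AP hR (fun _ => hAP.trans hA0) fun h' => absurd hA0 h'
  -- The split schedule refutes `AP` unless the three levels are SSI. Applied to `A₁` and `A₂`, this
  -- fixes the levels in the mixed allocation too.
  have hSSI : ∀ AP, Robust P AP →
      AP (σ (c 0)) = .SSI ∧ AP (σ (c 1)) = .SSI ∧ AP (σ (c (N - 1))) = .SSI := by
    intro AP hR
    by_contra h'
    exact hsplit AP hR (fun h => absurd h hA0) fun _ h1 h2 => h' ⟨h1, h2⟩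
  obtain ⟨h11, h12, h13⟩ := hSSI A₁ h₁
  obtain ⟨h21, h22, h23⟩ := hSSI A₂ h₂
  have hASSI : ∀ i, A₁ (σ i) = .SSI → A₂ (σ i) = .SSI → A i = .SSI := by
    intro i h1 h2
    rw [hAB]
    rcases hB (σ i) with h' | h'
    · rw [h', h1]
    · rw [h', h2]
  have hSN := hASSI _ h13 h23
  have hrwN : s.RWDep (b (N - 1)) (a (N - 1)) := hreturn.resolve_right fun h' => hA0 h'.1
  have hsnapF : ∀ w : Act 𝒯, A w.1 = .SSI → snapshot A w = first 𝒯 w.1 :=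
    fun w hw => snapshot_of_ne (by simp [hw])
  have hf0 : s.lt (first 𝒯 (c 0)) (.commit (c 1)) := by
    have hS := hASSI _ h11 h21
    rw [← hb 0] at hS ⊢
    rw [← hsnapF _ hS]
    exact hsnap0
  have hf1 : s.lt (first 𝒯 (c 1)) (.commit (c 0)) := by
    refine s.lt_trans _ _ _ ?_ h10
    have := s.first_lt_commit (a 0)
    rwa [ha] at this
  have hfN : s.lt (first 𝒯 (c (N - 1))) (.commit (c 0)) := by
    have hlt := h.snapshot_lt_commit_of_rwDep hrwN
    rw [hlast] at hlt
    rw [← hb] at hSN ⊢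
    rwa [← hsnapF _ hSN]
  refine h.2.2 ⟨c (N - 1), c 0, c 1, hSN, hASSI _ h11 h21, hASSI _ h12 h22,
    ⟨_, _, hb _, hlast, hrwN⟩, ⟨_, _, hb 0, ha 0, hrw0⟩, ⟨hfN, hmin _ _ hf0⟩, ⟨hf0, hf1⟩, ?_, h10,
    fun hro => ?_⟩
  · by_cases he : c 1 = c (N - 1)
    · exact .inl he
    · exact .inr (Schedule.commit_lt_commit he (hi₀ _))
  -- A read-only `c (N - 1)` is entered by a wr-dependency, so `c (N - 2)`, and with it `c 1`,
  -- commits before its first operation. The case `N = 2` is impossible because `c 1` writes.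
  · have hw : ¬ (Act.op (a (N - 2))).IsWrite := by
      refine hro _ ?_
      rw [ha, show N - 2 + 1 = N - 1 by omega]
    have hN2 : N ≠ 2 := by
      rintro rfl
      exact hw hrw0.1.isWrite
    have hlt := h.commit_lt_snapshot_of_wrDep ((hd (N - 2)).wrDep_of_not_isWrite hw)
    have haN : (a (N - 2)).1 = c (N - 1) := by
      rw [ha, show N - 2 + 1 = N - 1 by omega]
    rw [hb, hsnapF _ (haN ▸ hSN), haN] at hlt
    by_cases he : c 1 = c (N - 2)
    · rwa [he]
    · exact s.lt_trans _ _ _ (Schedule.commit_lt_commit he (hi₀ _)) hlt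

end TxnRobustness

open TxnRobustness in
theorem mainTheorem5 (S : Schema) (P : Set (Template S)) (A₁ A₂ : TemplateAllocation P) :
    (A₁ ≤ A₂ → Robust P A₁ → Robust P A₂) ∧
    ((∀ τ ∈ P, ∀ o ∈ τ, o.IsWrite → o.writeSet.Nonempty) →
      Robust P A₁ → Robust P A₂ → ∀ τ : P, Robust P (A₂.reassign τ (A₁ τ))) := by
  classical
  refine ⟨fun hle h => h.mono hle, fun hP h₁ h₂ τ => h₁.of_forall_eq_or_eq hP h₂ fun ρ => ?_⟩
  unfold TemplateAllocation.reassign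
  by_cases h : ρ = τ
  · subst h
    exact .inl (Function.update_self ..)
  · exact .inr (Function.update_of_ne h ..)
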